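/- **Generalized Mount's lemma.** Let $P\subset\mathbb R^{d+1}$ be a convex polyhedron of dimension $d+1$, i.e. a finite intersection of closed half-spaces, possibly unbounded, not contained in a proper affine subspace. Let $S=\partial P$, a polyhedral complex of dimension $d$ whose facets and ridges are its faces of dimension $d$ and $d-1$. For $a,b\in S$ let $\mu(a,b)$ be the infimum of the lengths of paths in $S$ from $a$ to $b$; a shortest path is one whose length equals $\mu(a,b)$. For a facet $F$ let $T_F\subset\mathbb R^{d+1}$ be its affine span. If facets $F,F'$ share a ridge $R=F\cap F'$, let $\Phi_{F,F'}\colon T_F\to T_{F'}$ be the isometry that fixes $R$ pointwise and for which $\Phi_{F,F'}(F)$ does not meet the relative interior of $F'$. Fix a source point $v$ in the relative interior of some facet. A point $\nu\in T_F$ is called a *source image* for the facet $F$ if there are a point $x\in F$ lying on no face of $S$ of dimension at most $d-2$, and a shortest path $\gamma$ in $S$ between $x$ and $v$ that, followed from $x$ to $v$, traverses the relative interiors of facets $F=F_1,F_2,\dots,F_\ell$ in this order, with $F_i\cap F_{i+1}$ a ridge for all $i<\ell$ (where, if $x$ lies on the ridge $F_1\cap F_2$, the path may meet $F_1$ in $x$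 only), such that the sequential unfolding $$\bigcup_{i=1}^{\ell}\Phi_{F_1,F_2}^{-1}\circ\cdots\circ\Phi_{F_{i-1},F_i}^{-1}(\gamma\cap F_i)\subset T_F$$ of $\gamma$ is the straight segment $[\nu,x]$, with $v$ unfolding to $\nu$. If $F$ is a facet of $S$, $\nu$ is a source image for $F$, and $w\in F$, then the straight segment $[\nu,w]\subset T_F$ has length at least $\mu(v,w)$. -/

import Mathlib

open scoped ENNReal

/-- The ambient Euclidean space `ℝ^(d+1)`. -/
abbrev Amb (d : ℕ) : Type := EuclideanSpace ℝ (Fin (d + 1))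

/-- `P` is a convex polyhedron of dimension `d + 1` in `ℝ^(d+1)`: a finite intersection of closed
half-spaces (possibly unbounded) that does not lie in a proper affine subspace. -/
def IsConvexPolyhedron {d : ℕ} (P : Set (Amb d)) : Prop :=
  (∃ H : Set (Amb d × ℝ), H.Finite ∧ (∀ h ∈ H, h.1 ≠ 0) ∧
    P = {x | ∀ h ∈ H, inner ℝ h.1 x ≤ h.2}) ∧
  affineSpan ℝ P = ⊤

/-- Dimension of a nonempty face: the dimension of its affine span. -/
noncomputable def faceDim {d : ℕ} (G : Set (Amb d)) : ℕ :=
  Module.finrank ℝ (affineSpan ℝ G).direction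

/-- The faces of the polyhedral cell complex `∂P`: the nonempty proper faces of `P`.
(A nonempty set is exposed in `P` if it consists of the maximizers over `P` of some linear
functional.) -/
def IsBoundaryFace {d : ℕ} (P G : Set (Amb d)) : Prop :=
  G.Nonempty ∧ IsExposed ℝ P G ∧ G ≠ P

/-- Facets: faces of `∂P` of dimension `d`. -/
def IsFacet {d : ℕ} (P F : Set (Amb d)) : Prop :=
  IsBoundaryFace P F ∧ faceDim F = d

/-- Ridges: faces of `∂P` of dimension `d - 1`. -/
def IsRidge {d : ℕ} (P R : Set (Amb d)) : Prop :=
  IsBoundaryFace P R ∧ faceDim R + 1 = d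

/-- Warped points: points lying on a face of dimension at most `d - 2`. -/
def IsWarped {d : ℕ} (P : Set (Amb d)) (x : Amb d) : Prop :=
  ∃ G, IsBoundaryFace P G ∧ faceDim G + 2 ≤ d ∧ x ∈ G

/-- Euclidean length of a path (its total variation). -/
noncomputable def pathLength {d : ℕ} {a b : Amb d} (γ : Path a b) : ℝ≥0∞ :=
  eVariationOn γ Set.univ

/-- The geodesic distance `μ(a, b)` in `S`: the infimum of the lengths of the paths from `a` to `b`
inside `S` (it is `⊤` if there is none). -/
noncomputable def geodesicDist {d : ℕ} (S : Set (Amb d)) (a b : Amb d) : ℝ≥0∞ :=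
  ⨅ (γ : Path a b) (_ : ∀ s, γ s ∈ S), pathLength γ

/-- `γ` is a shortest path in `S`. -/
def IsShortestPath {d : ℕ} (S : Set (Amb d)) {a b : Amb d} (γ : Path a b) : Prop :=
  (∀ s, γ s ∈ S) ∧ pathLength γ = geodesicDist S a b

/-- `Φ` is (a rigid motion of the ambient space restricting to) the folding map `T_F → T_{F'}` of
two facets sharing the ridge `F ∩ F'`: it carries the affine span `T_F` of `F` isometrically onto
that of `F'`, fixes the common ridge pointwise, and the image of `F` does not intersect the
interior of `F'`. Only the values of `Φ` on `T_F` matter, and these are determined by the three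
conditions. -/
structure IsFoldingMap {d : ℕ} (F F' : Set (Amb d)) (Φ : Amb d ≃ᵢ Amb d) : Prop where
  image_span : Φ '' (affineSpan ℝ F : Set (Amb d)) = (affineSpan ℝ F' : Set (Amb d))
  fix_ridge : ∀ p ∈ F ∩ F', Φ p = p
  disjoint_interior : Disjoint (Φ '' F) (intrinsicInterior ℝ F')

/-- `γ`, followed from its starting point `x`, runs through the facets `L 0, …, L n` in this order,
consecutive facets sharing a ridge: there are times `0 = t 0 ≤ t 1 < ⋯ < t (n+1) = 1` such that
`γ` is in the relative interior of `L i` between the times `t i` and `t (i+1)`. Only the first time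
interval may degenerate to a point (if `n > 0`); then `x` lies on the ridge `L 0 ∩ L 1`. -/
structure Traverses {d : ℕ} (P : Set (Amb d)) {x v : Amb d} (γ : Path x v) (n : ℕ)
    (L : ℕ → Set (Amb d)) : Prop where
  facet : ∀ i ≤ n, IsFacet P (L i)
  ridge : ∀ i < n, IsRidge P (L i ∩ L (i + 1))
  start_mem : x ∈ L 0
  times : ∃ t : ℕ → unitInterval, t 0 = 0 ∧ t (n + 1) = 1 ∧
    (∀ i, 1 ≤ i → i ≤ n → t i < t (i + 1)) ∧
    ∀ i ≤ n, ∀ s, t i < s → s < t (i + 1) → γ s ∈ intrinsicInterior ℝ (L i)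

/-- For folding maps `Φ i : T_{L i} → T_{L (i+1)}`, the composite
`(Φ 0)⁻¹ ∘ (Φ 1)⁻¹ ∘ ⋯ ∘ (Φ (i-1))⁻¹`, which unfolds `T_{L i}` onto `T_{L 0}`. -/
noncomputable def unfoldMap {d : ℕ} (Φ : ℕ → (Amb d ≃ᵢ Amb d)) : ℕ → (Amb d ≃ᵢ Amb d)
  | 0 => IsometryEquiv.refl (Amb d)
  | i + 1 => (Φ i).symm.trans (unfoldMap Φ i)

/-- The sequential unfolding of `Γ` along `L 0, …, L n`: the union of the unfolded pieces
`Γ ∩ L i` in `T_{L 0}`. -/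
def sequentialUnfolding {d : ℕ} (Φ : ℕ → (Amb d ≃ᵢ Amb d)) (n : ℕ) (L : ℕ → Set (Amb d))
    (Γ : Set (Amb d)) : Set (Amb d) :=
  ⋃ i ∈ Set.Iic n, unfoldMap Φ i '' (Γ ∩ L i)

/-- `ν` is a source image for the facet `F` of `∂P`, with respect to the source point `v`: some
shortest path between `v` and a point `x` of `F` that is not warped unfolds sequentially into `T_F`
as the segment `[ν, x]`, its end `ν` being the unfolded copy of `v`. The path is run from `x` to
`v`, since the unfolding starts at `F`. -/
def IsSourceImage {d : ℕ} (P : Set (Amb d)) (v : Amb d) (F : Set (Amb d)) (ν : Amb d) : Prop :=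
  ∃ x ∈ F, ¬ IsWarped P x ∧
    ∃ γ : Path x v, IsShortestPath (frontier P) γ ∧
      ∃ (n : ℕ) (L : ℕ → Set (Amb d)) (Φ : ℕ → (Amb d ≃ᵢ Amb d)),
        L 0 = F ∧ Traverses P γ n L ∧
        (∀ i < n, IsFoldingMap (L i) (L (i + 1)) (Φ i)) ∧
        unfoldMap Φ n v = ν ∧
        sequentialUnfolding Φ n L (Set.range γ) = segment ℝ ν x

/-! Let `T 0, …, T n` be the hyperplanes spanned by the facets `L 0 = F, …, L n` that the shortest
path crosses. The geodesic distance μ(v, ·) is replaced on `F` by a chain distance D: the infimum of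
the lengths of broken lines from `v` with at most `n + 1` edges, each edge in some `T i` and the
last in `T 0`. Chains may leave `P`, so no lower-dimensional face obstructs their variation. Three
facts carry the proof.

(1) μ(v, z) ≤ D(z). The hyperplanes miss the interior of `P`, so the nearest point map of `P`, which
is 1-Lipschitz, sends a chain to a path in the boundary that is no longer
(`FlatChain.geodesicDist_le`).

(2) D ≤ |ν - ·| near `x` in `F`, since the straight segment from `ν` folds up to a chain
(`unfolding_induction`). At `x` equality holds by (1), because |ν - x| = μ(v, x).

(3) D² - |·|² is concave on `F`. At a vertex of a shortest chain both edges make matching angles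
with the crossing `T i ∩ T j`, so the chain unfolds to a segment from some ν', and nearby points are
reached by chains of length at most |ν' - ·| (`FlatChain.exists_barrier`). Thus the affine function
|ν' - ·|² - |·|² touches D² - |·|² from above. Local affine upper barriers force concavity
(`chord_le_of_affine_barrier`); points of `F` on other hyperplanes follow by continuity.

By (2) the affine function |ν - ·|² - |·|² dominates this concave function near `x` with equality at
`x`, hence on all of `F` (`chainDist_le_dist`). At `w` this reads μ(v, w) ≤ D(w) ≤ |ν - w|. -/

open Filter Topology

/-! ### Broken lines in a family of sets, and existence of shortest ones -/

section Chains

variable {ι E : Type*}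

/-- `FlatChain T v k i z r`: there is a broken line of length `r` with `k` edges from `v` to `z`, each
edge having both ends in one of the sets `T j`, and the last edge having its ends in `T i`. -/
inductive FlatChain [Dist E] (T : ι → Set E) (v : E) : ℕ → ι → E → ℝ → Prop
  | single {i : ι} {z : E} : v ∈ T i → z ∈ T i → FlatChain T v 1 i z (dist v z)
  | snoc {k : ℕ} {i j : ι} {q z : E} {r : ℝ} : FlatChain T v k i q r → q ∈ T j → z ∈ T j →
      FlatChain T v (k + 1) j z (r + dist q z)

theorem FlatChain.mem [Dist E] {T : ι → Set E} {v : E} {k : ℕ} {i : ι} {z : E} {r : ℝ}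
    (h : FlatChain T v k i z r) : z ∈ T i := by
  cases h <;> assumption

theorem FlatChain.pos [Dist E] {T : ι → Set E} {v : E} {k : ℕ} {i : ι} {z : E} {r : ℝ}
    (h : FlatChain T v k i z r) : 0 < k := by
  cases h <;> omega

theorem FlatChain.dist_le [PseudoMetricSpace E] {T : ι → Set E} {v : E} {k : ℕ} {i : ι} {z : E}
    {r : ℝ} (h : FlatChain T v k i z r) : dist v z ≤ r := by
  induction h with
  | single => exact le_rfl
  | @snoc k i j q z r h hq hz ih => linarith [dist_triangle v q z]

theorem FlatChain.congr_last [Dist E] {T : ι → Set E} {v : E} {k : ℕ} {i j : ι} {z : E} {r : ℝ}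
    (h : FlatChain T v k i z r) (hij : T i = T j) : FlatChain T v k j z r := by
  cases h with
  | single h1 h2 => exact .single (hij ▸ h1) (hij ▸ h2)
  | snoc h h1 h2 => exact .snoc h (hij ▸ h1) (hij ▸ h2)

theorem FlatChain.move_last [PseudoMetricSpace E] {T : ι → Set E} {v : E} {k : ℕ} {i : ι} {z : E}
    {r : ℝ} (h : FlatChain T v k i z r) {z' : E} (hz' : z' ∈ T i) :
    ∃ r', FlatChain T v k i z' r' ∧ r' ≤ r + dist z z' := by
  cases h with
  | single h1 h2 => exact ⟨_, .single h1 hz', dist_triangle _ _ _⟩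
  | @snoc k j _ q _ r h h1 h2 =>
    exact ⟨_, .snoc h h1 hz', by linarith [dist_triangle q z z']⟩

/-- Compactness: the length of a chain bounds the distance of its vertices from `v`, so the last
vertices before the ends have a convergent subsequence. This is what makes minimal lengths attained,
and why the number of edges is kept fixed. -/
theorem FlatChain.isClosed [Finite ι] [PseudoMetricSpace E] [ProperSpace E] {T : ι → Set E}
    (hT : ∀ i, IsClosed (T i)) (v : E) (k : ℕ) (i : ι) :
    IsClosed {p : E × ℝ | FlatChain T v k i p.1 p.2} := by
  induction k generalizing i with
  | zero =>
    convert isClosed_empty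
    exact Set.eq_empty_of_forall_notMem fun p hp => absurd (FlatChain.pos hp) (lt_irrefl 0)
  | succ k ih =>
    have key : {p : E × ℝ | FlatChain T v (k + 1) i p.1 p.2} =
        {p : E × ℝ | (k = 0 ∧ v ∈ T i) ∧ (p.1 ∈ T i ∧ p.2 = dist v p.1)} ∪
        ⋃ j, {p : E × ℝ | ∃ q, (q ∈ T i ∧ p.1 ∈ T i) ∧ FlatChain T v k j q (p.2 - dist q p.1)} := by
      ext ⟨z, r⟩
      simp only [Set.mem_ofPred_eq, Set.mem_union, Set.mem_iUnion]
      constructor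
      · intro h
        cases h with
        | single h1 h2 => exact Or.inl ⟨⟨rfl, h1⟩, h2, rfl⟩
        | @snoc _ j _ q _ r h h1 h2 => exact Or.inr ⟨j, q, ⟨h1, h2⟩, by simpa using h⟩
      · rintro (⟨⟨rfl, h1⟩, h2, rfl⟩ | ⟨j, q, ⟨h1, h2⟩, h⟩)
        · exact .single h1 h2
        · simpa using FlatChain.snoc h h1 h2
    rw [key]
    refine IsClosed.union ?_ (isClosed_iUnion_of_finite fun j => ?_)
    · refine isClosed_const.inter (((hT i).preimage continuous_fst).inter ?_)
      exact isClosed_eq continuous_snd (by fun_prop)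
    · refine isClosed_of_closure_subset fun p hp => ?_
      obtain ⟨u, hu, hlim⟩ := mem_closure_iff_seq_limit.1 hp
      choose q hq hqc using hu
      have h1 : Tendsto (fun n => (u n).1) atTop (𝓝 p.1) := (continuous_fst.tendsto p).comp hlim
      have h2 : Tendsto (fun n => (u n).2) atTop (𝓝 p.2) := (continuous_snd.tendsto p).comp hlim
      obtain ⟨C, hC⟩ := h2.bddAbove_range
      have hb : ∀ n, q n ∈ Metric.closedBall v C := fun n => by
        have := (hqc n).dist_le
        have h3 : (u n).2 ≤ C := hC ⟨n, rfl⟩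
        rw [Metric.mem_closedBall, dist_comm]
        linarith [dist_nonneg (x := q n) (y := (u n).1)]
      obtain ⟨a, -, φ, hφ, ha⟩ := (isCompact_closedBall v C).tendsto_subseq hb
      have h1' := h1.comp hφ.tendsto_atTop
      have h2' := h2.comp hφ.tendsto_atTop
      refine ⟨a, ⟨(hT i).mem_of_tendsto ha (.of_forall fun n => (hq _).1),
        (hT i).mem_of_tendsto h1' (.of_forall fun n => (hq _).2)⟩, ?_⟩
      have := (ih j).mem_of_tendsto (f := fun n => (q (φ n), (u (φ n)).2 - dist (q (φ n)) (u (φ n)).1))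
        (b := atTop) (x := (a, p.2 - dist a p.1))
        (ha.prodMk_nhds (h2'.sub (ha.dist h1'))) (.of_forall fun n => hqc _)
      exact this

/-- A chain is tight if no chain with at most as many edges and with the same end is shorter, or as
long but with fewer edges. -/
def IsTight [Dist E] (T : ι → Set E) (v : E) (k : ℕ) (z : E) (r : ℝ) : Prop :=
  ∀ k' ≤ k, ∀ i r', FlatChain T v k' i z r' → r ≤ r' ∧ (r' = r → k ≤ k')

/-- Optimal substructure: a better competitor for the initial part, continued by the same last edge,
would beat the whole chain. -/
theorem IsTight.of_snoc [Dist E] {T : ι → Set E} {v : E} {k : ℕ} {j : ι} {q z : E} {r : ℝ}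
    (h : IsTight T v (k + 1) z (r + dist q z)) (hq : q ∈ T j) (hz : z ∈ T j) :
    IsTight T v k q r := by
  intro k' hk' i r' hc
  obtain ⟨h1, h2⟩ := h (k' + 1) (by omega) j _ (hc.snoc hq hz)
  exact ⟨by linarith, fun h3 => by have := h2 (by rw [h3]); omega⟩

/-- Among the chains with at most `N` edges that end at a given point, some tight one has minimal
length. -/
theorem exists_tight_chain [Finite ι] [PseudoMetricSpace E] [ProperSpace E] {T : ι → Set E}
    (hT : ∀ i, IsClosed (T i)) {v z : E} {N : ℕ} (hne : ∃ k ≤ N, ∃ i r, FlatChain T v k i z r) :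
    ∃ k ≤ N, ∃ i r, FlatChain T v k i z r ∧ IsTight T v k z r ∧
      ∀ k' ≤ N, ∀ i' r', FlatChain T v k' i' z r' → r ≤ r' := by
  classical
  set S : Set ℝ := ⋃ k : Fin (N + 1), ⋃ i : ι, {r | FlatChain T v k i z r} with hS
  have hcl : IsClosed S := isClosed_iUnion_of_finite fun k => isClosed_iUnion_of_finite fun i =>
    (FlatChain.isClosed hT v k i).preimage (Continuous.prodMk_right z)
  have hmem : ∀ r, r ∈ S ↔ ∃ k ≤ N, ∃ i, FlatChain T v k i z r := by
    intro r
    simp only [hS, Set.mem_iUnion, Set.mem_ofPred_eq]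
    constructor
    · rintro ⟨k, i, h⟩
      exact ⟨k, by omega, i, h⟩
    · rintro ⟨k, hk, i, h⟩
      exact ⟨⟨k, by omega⟩, i, h⟩
  have hSne : S.Nonempty := by
    obtain ⟨k, hk, i, r, h⟩ := hne
    exact ⟨r, (hmem r).2 ⟨k, hk, i, h⟩⟩
  have hbd : BddBelow S := by
    refine ⟨0, fun r hr => ?_⟩
    obtain ⟨k, hk, i, h⟩ := (hmem r).1 hr
    exact dist_nonneg.trans h.dist_le
  have hmin := hcl.csInf_mem hSne hbd
  have hex := (hmem _).1 hmin
  -- Among the chains of minimal length, one with the fewest edges is taken; this yields the second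
  -- clause of tightness.
  have hk := Nat.find_spec hex
  obtain ⟨hkN, i, hc⟩ := hk
  refine ⟨_, hkN, i, _, hc, fun k' hk' i' r' hc' => ⟨?_, fun h => ?_⟩, fun k' hk' i' r' hc' => ?_⟩
  · exact csInf_le hbd ((hmem r').2 ⟨k', hk'.trans hkN, i', hc'⟩)
  · exact Nat.find_min' hex ⟨hk'.trans hkN, i', h ▸ hc'⟩
  · exact csInf_le hbd ((hmem r').2 ⟨k', hk', i', hc'⟩)

end Chains

/-! ### Stability of the crossing of a segment with a hyperplane -/

section Crossing

variable {E : Type*} [NormedAddCommGroup E] [NormedSpace ℝ E]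

/-- If the segment from `ν`, on the positive side of the hyperplane `l = c`, to `z₀` crosses it at `q`,
then so do the segments from `ν` to nearby points, close to `q`. -/
theorem eventually_crossing (l : E →L[ℝ] ℝ) {c : ℝ} {ν z₀ q : E} (hν : c < l ν)
    (hq : q ∈ segment ℝ ν z₀) (hqc : l q = c) {U : Set E} (hU : U ∈ 𝓝 q) :
    ∀ᶠ z in 𝓝 z₀, l z ≤ c → ∃ q' ∈ segment ℝ ν z, l q' = c ∧ q' ∈ U := by
  have hz₀ : l z₀ < l ν := by
    rw [segment_eq_image_lineMap] at hq
    obtain ⟨t, ⟨ht0, ht1⟩, rfl⟩ := hq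
    rw [AffineMap.lineMap_apply_module, map_add, map_smul, map_smul, smul_eq_mul, smul_eq_mul] at hqc
    by_contra! h
    nlinarith
  -- Parameter at which the line from `ν` to `z` meets `l = c`; it is continuous near `z₀` because
  -- `l z₀ < l ν`.
  set τ : E → ℝ := fun z => (l ν - c) / (l ν - l z) with hτ
  have hcont : ContinuousAt (fun z => AffineMap.lineMap (k := ℝ) ν z (τ z)) z₀ := by
    have : ContinuousAt τ z₀ := by
      refine ContinuousAt.div (by fun_prop) (by fun_prop) (by linarith)
    simp only [AffineMap.lineMap_apply_module]
    fun_prop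
  have hval : AffineMap.lineMap (k := ℝ) ν z₀ (τ z₀) = q := by
    rw [segment_eq_image_lineMap] at hq
    obtain ⟨t, ⟨ht0, ht1⟩, rfl⟩ := hq
    congr 1
    rw [AffineMap.lineMap_apply_module, map_add, map_smul, map_smul, smul_eq_mul, smul_eq_mul] at hqc
    rw [hτ]
    have : l ν - l z₀ ≠ 0 := by linarith
    field_simp
    linarith
  have hev := hcont.eventually_mem (s := U) (show U ∈ 𝓝 _ from hval ▸ hU)
  filter_upwards [hev] with z hz hzc
  have hpos : 0 < l ν - l z := by linarith
  refine ⟨_, ?_, ?_, hz⟩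
  · rw [segment_eq_image_lineMap]
    refine ⟨τ z, ⟨div_nonneg (by linarith) hpos.le, ?_⟩, rfl⟩
    rw [hτ, div_le_one hpos]
    linarith
  · rw [AffineMap.lineMap_apply_module, map_add, map_smul, map_smul, smul_eq_mul, smul_eq_mul, hτ]
    field_simp
    ring

end Crossing

/-! ### Euclidean upper barriers from unfolding tight chains -/

section Barrier

variable {ι E : Type*} [NormedAddCommGroup E] [InnerProductSpace ℝ E]

/-- First order condition at a vertex of a shortest broken line: if `q` locally minimizes
`|v - ·| + |· - z|` on a translate of the subspace `W`, then rotating the first edge into the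
continuation of the second one does not change the distances to the points of that translate. -/
theorem dist_eq_dist_of_isLocalMin {v z q : E} (hvq : v ≠ q) (hzq : z ≠ q) {W : Submodule ℝ E}
    (hmin : ∀ᶠ p in 𝓝 q, p - q ∈ W → dist v q + dist q z ≤ dist v p + dist p z)
    {p : E} (hp : p - q ∈ W) :
    dist v p = dist (q - (dist v q / dist z q) • (z - q)) p := by
  set w := p - q with hw
  have hv0 : v - q ≠ 0 := sub_ne_zero.2 hvq
  have hz0 : z - q ≠ 0 := sub_ne_zero.2 hzq
  have hnv : 0 < ‖v - q‖ := norm_pos_iff.2 hv0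
  have hnz : 0 < ‖z - q‖ := norm_pos_iff.2 hz0
  -- The derivative of the total length along `w` vanishes at `q`: the two unit edge directions have
  -- opposite components along `w`.
  have hcrit : inner ℝ (v - q) w / ‖v - q‖ + inner ℝ (z - q) w / ‖z - q‖ = 0 := by
    have hd : ∀ a : E, a ≠ 0 → HasDerivAt (fun t : ℝ => ‖a - t • w‖) (- (inner ℝ a w / ‖a‖)) 0 := by
      intro a ha
      have h1 : HasDerivAt (fun t : ℝ => a - t • w) (-w) 0 := by
        simpa using (((hasDerivAt_id (0 : ℝ)).smul_const w).const_sub a)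
      have h2 := h1.norm_sq.sqrt (by simpa using ha)
      have h3 : (fun t : ℝ => ‖a - t • w‖) = fun t : ℝ => √(‖a - t • w‖ ^ 2) := by
        ext t
        rw [Real.sqrt_sq (norm_nonneg _)]
      rw [h3]
      convert h2 using 1
      have : ‖a‖ ≠ 0 := norm_ne_zero_iff.2 ha
      simp only [zero_smul, sub_zero, inner_neg_right, Real.sqrt_sq (norm_nonneg a)]
      field_simp
    have hlm : IsLocalMin (fun t : ℝ => ‖(v - q) - t • w‖ + ‖(z - q) - t • w‖) 0 := by
      have hc : Tendsto (fun t : ℝ => q + t • w) (𝓝 0) (𝓝 q) := by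
        have : Continuous fun t : ℝ => q + t • w := by fun_prop
        simpa using this.tendsto 0
      filter_upwards [hc.eventually hmin] with t ht
      have := ht (by simpa using W.smul_mem t hp)
      simp only [zero_smul, sub_zero]
      rw [dist_eq_norm, dist_comm q z, dist_eq_norm, dist_eq_norm, dist_comm _ z, dist_eq_norm] at this
      rw [sub_sub, sub_sub]
      exact this
    have := hlm.hasDerivAt_eq_zero ((hd _ hv0).add (hd _ hz0))
    linarith
  have e1 : v - p = (v - q) - w := by rw [hw]; abel
  have e2 : q - (dist v q / dist z q) • (z - q) - p = -((dist v q / dist z q) • (z - q) + w) := by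
    rw [hw]; abel
  rw [dist_eq_norm, dist_eq_norm, e1, e2, norm_neg, ← sq_eq_sq₀ (norm_nonneg _) (norm_nonneg _),
    norm_sub_sq_real, norm_add_sq_real, norm_smul, inner_smul_left, dist_eq_norm, dist_eq_norm,
    Real.norm_of_nonneg (by positivity)]
  simp only [conj_trivial]
  field_simp at hcrit ⊢
  linarith

/-- The tail of a chain can be varied: if `q` is the last vertex of a chain, seen as at distance
`dist ν q` from a point `ν`, then chains to points near `z` are obtained by crossing near `q`. -/
theorem eventually_chain_snoc {T : ι → Set E} {v : E} {k : ℕ} {i j : ι} {ν ν' q z : E}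
    {l : E →L[ℝ] ℝ} {c : ℝ} {B : Set E} (hTj : Convex ℝ (T j)) (hν'j : ν' ∈ T j)
    (hdist : ∀ p ∈ T j, l p = c → dist ν p = dist ν' p)
    (hB : ∀ᶠ p in 𝓝 q, p ∈ T j → l p = c → p ∈ B)
    (hq : ∀ᶠ p in 𝓝[B] q, ∃ r, FlatChain T v k i p r ∧ r ≤ dist ν p)
    (hν' : c < l ν') (hqz : q ∈ segment ℝ ν' z) (hqc : l q = c) :
    ∀ᶠ p in 𝓝 z, p ∈ T j → l p ≤ c →
      ∃ r, FlatChain T v (k + 1) j p r ∧ r ≤ dist ν' p := by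
  filter_upwards [eventually_crossing l hν' hqz hqc (hB.and (eventually_nhdsWithin_iff.1 hq))]
    with p hp hpj hpc
  obtain ⟨q', hq's, hq'c, hq'B, hq'⟩ := hp hpc
  have hq'j : q' ∈ T j := hTj.segment_subset hν'j hpj hq's
  obtain ⟨r, hr, hrd⟩ := hq' (hq'B hq'j hq'c)
  refine ⟨_, hr.snoc hq'j hpj, ?_⟩
  rw [← dist_add_dist_of_mem_segment hq's, ← hdist _ hq'j hq'c]
  linarith

/-- Near the end of a tight chain the chain distance has a Euclidean distance as an upper barrier. -/
theorem FlatChain.exists_barrier {l : ι → E →L[ℝ] ℝ} {c : ι → ℝ} {T : ι → Set E}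
    (hT : ∀ i, T i = {z | l i z = c i}) {v : E} {k : ℕ} {i : ι} {z : E} {r : ℝ}
    (h : FlatChain T v k i z r) (ht : IsTight T v k z r) :
    ∃ ν ∈ T i, dist ν z = r ∧
      ∀ᶠ p in 𝓝[T i] z, ∃ r', FlatChain T v k i p r' ∧ r' ≤ dist ν p := by
  induction h with
  | @single i z hv hz =>
    refine ⟨v, hv, rfl, ?_⟩
    filter_upwards [self_mem_nhdsWithin] with p hp
    exact ⟨_, .single hv hp, le_rfl⟩
  | @snoc k i j q z r h hqj hzj ih =>
    obtain ⟨ν, hνi, hνr, hν⟩ := ih (ht.of_snoc hqj hzj)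
    have hqi := h.mem
    have hkpos := h.pos
    have hconv : ∀ i, Convex ℝ (T i) := fun i => by
      rw [hT]; exact convex_hyperplane (l i).toLinearMap.isLinear _
    -- Otherwise the last two edges would both lie in `T i` and could be merged into one, with no
    -- gain in length and one edge fewer.
    have hzi : z ∉ T i := by
      intro hzi
      cases h with
      | single h1 h2 =>
        have := (ht 1 (by omega) _ _ (.single h1 hzi))
        have h3 := this.2 (le_antisymm (dist_triangle _ _ _) this.1)
        omega
      | @snoc k i' _ p _ r h h1 h2 =>
        have := (ht (k + 1) (by omega) _ _ (h.snoc h1 hzi))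
        have h3 := this.2 (le_antisymm (by linarith [dist_triangle p q z]) this.1)
        omega
    have hzq : z ≠ q := fun e => hzi (e ▸ hqi)
    have hνq : ν ≠ q := by
      rintro rfl
      rw [dist_self] at hνr
      have hvq : v = ν := dist_le_zero.1 (h.dist_le.trans hνr.ge)
      have := (ht 1 (by omega) j _ (.single (hvq ▸ hqj) hzj)).2 (by rw [← hνr, hvq]; simp)
      omega
    have hνpos : 0 < dist ν q := dist_pos.2 hνq
    have hzpos : 0 < dist z q := dist_pos.2 hzq
    set W : Submodule ℝ E := LinearMap.ker (l i).toLinearMap ⊓ LinearMap.ker (l j).toLinearMap with hW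
    have hWmem : ∀ p, p - q ∈ W ↔ p ∈ T i ∧ p ∈ T j := by
      intro p
      rw [hT] at hqi hqj
      simp only [Set.mem_ofPred_eq] at hqi hqj
      rw [hW, hT, hT]
      simp [Submodule.mem_inf, LinearMap.mem_ker, hqi, hqj, sub_eq_zero]
    -- The barrier at `q` turns `dist ν p` into the length of an actual chain to `p`; appending the
    -- edge to `z` gives a competitor for the tight chain.
    have hmin : ∀ᶠ p in 𝓝 q, p - q ∈ W → dist ν q + dist q z ≤ dist ν p + dist p z := by
      filter_upwards [eventually_nhdsWithin_iff.1 hν] with p hp hpW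
      obtain ⟨hpi, hpj⟩ := (hWmem p).1 hpW
      obtain ⟨r', hr', hle⟩ := hp hpi
      have := (ht _ le_rfl j _ (hr'.snoc hpj hzj)).1
      linarith
    set s := dist ν q / dist z q with hs
    have hspos : 0 < s := div_pos hνpos hzpos
    -- The new centre extends the last edge backwards beyond `q`, by the distance `dist ν q`.
    set ν' := q - s • (z - q) with hν'
    have hdist : ∀ p, p ∈ T i → p ∈ T j → dist ν p = dist ν' p := fun p hpi hpj =>
      dist_eq_dist_of_isLocalMin hνq hzq hmin ((hWmem p).2 ⟨hpi, hpj⟩)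
    have hν'j : ν' ∈ T j := by
      rw [hT] at hqj hzj ⊢
      simp only [Set.mem_ofPred_eq] at hqj hzj ⊢
      simp [hν', hqj, hzj]
    have hseg : q ∈ segment ℝ ν' z := by
      refine ⟨1 / (1 + s), s / (1 + s), by positivity, by positivity, by field_simp, ?_⟩
      rw [hν', ← sub_eq_zero]
      have : (1 + s) ≠ 0 := by positivity
      match_scalars <;> field_simp <;> ring
    refine ⟨ν', hν'j, ?_, ?_⟩
    · rw [← dist_add_dist_of_mem_segment hseg, ← hdist q hqi hqj, hνr]
    · have hli : l i ν' - c i = - s * (l i z - c i) := by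
        rw [hT] at hqi
        simp only [Set.mem_ofPred_eq] at hqi
        simp [hν', hqi]
      rw [eventually_nhdsWithin_iff]
      rw [hT] at hqi hzi
      simp only [Set.mem_ofPred_eq] at hqi hzi
      -- The points `z` and `ν'` lie strictly on opposite sides of `T i`; the second case is the
      -- first with `l i` and `c i` negated.
      rcases lt_or_gt_of_ne hzi with hlt | hgt
      · have h1 := eventually_chain_snoc (T := T) (l := l i) (c := c i) (B := T i) (hconv j) hν'j
          (fun p hpj hpi => hdist p (by rw [hT]; exact hpi) hpj)
          (.of_forall fun p _ hp => by rw [hT]; exact hp) hν (by nlinarith) hseg hqi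
        filter_upwards [h1, (l i).continuous.continuousAt.eventually (gt_mem_nhds hlt)]
          with p hp hp' hpj
        exact hp hpj hp'.le
      · have h1 := eventually_chain_snoc (T := T) (l := -l i) (c := -c i) (B := T i) (hconv j) hν'j
          (fun p hpj hpi => hdist p (by rw [hT]; simpa using hpi) hpj)
          (.of_forall fun p _ hp => by rw [hT]; simpa using hp) hν
          (by simp only [neg_apply]; nlinarith) hseg (by simp [hqi])
        filter_upwards [h1, (l i).continuous.continuousAt.eventually (lt_mem_nhds hgt)]
          with p hp hp' hpj
        exact hp hpj (by simpa using hp'.le)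

end Barrier

/-! ### Concavity from local affine barriers -/

section Chord

/-- A continuous function on `[0, 1]` which has at each interior point a local upper barrier that is
affine lies above its chord. -/
theorem chord_le_of_affine_barrier {g : ℝ → ℝ} (hg : ContinuousOn g (Set.Icc 0 1))
    (hb : ∀ s ∈ Set.Ioo (0 : ℝ) 1, ∃ α β, g s = α + β * s ∧ ∀ᶠ s' in 𝓝 s, g s' ≤ α + β * s')
    {s : ℝ} (hs : s ∈ Set.Icc (0 : ℝ) 1) : (1 - s) * g 0 + s * g 1 ≤ g s := by
  set f : ℝ → ℝ := fun s => g s - ((1 - s) * g 0 + s * g 1) with hf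
  have hfc : ContinuousOn f (Set.Icc 0 1) := by
    refine hg.sub (Continuous.continuousOn (by fun_prop))
  obtain ⟨a₀, ha₀, hmin⟩ := isCompact_Icc.exists_isMinOn ⟨s, hs⟩ hfc
  have hmin : ∀ t ∈ Set.Icc (0 : ℝ) 1, f a₀ ≤ f t := fun t ht => hmin ht
  suffices 0 ≤ f a₀ by
    have := this.trans (hmin s hs)
    simp only [hf] at this
    linarith
  by_contra! hneg
  -- If the minimum is negative, its leftmost minimizer `a` is interior. The barrier gives `f (a -
  -- δ) + f (a + δ) ≤ 2 * f a`, so `a - δ` is a minimizer too, a contradiction.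
  set M : Set ℝ := Set.Icc 0 1 ∩ f ⁻¹' Set.Iic (f a₀) with hM
  have hMc : IsClosed M := hfc.preimage_isClosed_of_isClosed isClosed_Icc isClosed_Iic
  have hMb : BddBelow M := ⟨0, fun t ht => ht.1.1⟩
  have haM : sInf M ∈ M := hMc.csInf_mem ⟨a₀, ha₀, by simp⟩ hMb
  set a := sInf M with ha
  obtain ⟨⟨ha0, ha1⟩, hfa⟩ := haM
  have hfa : f a ≤ f a₀ := hfa
  have h0 : a ≠ 0 := by
    intro h
    rw [h] at hfa
    have : f 0 = 0 := by simp [hf]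
    linarith
  have h1 : a ≠ 1 := by
    intro h
    rw [h] at hfa
    have : f 1 = 0 := by simp [hf]
    linarith
  have hlt0 : 0 < a := lt_of_le_of_ne ha0 h0.symm
  have hlt1 : a < 1 := lt_of_le_of_ne ha1 h1
  obtain ⟨α, β, hab, hev⟩ := hb a ⟨hlt0, hlt1⟩
  obtain ⟨ε, hε, hball⟩ := Metric.eventually_nhds_iff.1 hev
  set δ := min (ε / 2) (min (a / 2) ((1 - a) / 2)) with hδ
  have hδ0 : 0 < δ := by
    have : 0 < 1 - a := by linarith
    positivity
  have hδε : δ ≤ ε / 2 := min_le_left _ _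
  have hδa : δ ≤ a / 2 := (min_le_right _ _).trans (min_le_left _ _)
  have hδb : δ ≤ (1 - a) / 2 := (min_le_right _ _).trans (min_le_right _ _)
  have hl : g (a - δ) ≤ α + β * (a - δ) := hball (by
    rw [Real.dist_eq, show a - δ - a = -δ by ring, abs_neg, abs_of_pos hδ0]; linarith)
  have hr : g (a + δ) ≤ α + β * (a + δ) := hball (by
    rw [Real.dist_eq, show a + δ - a = δ by ring, abs_of_pos hδ0]; linarith)
  have hr' := hmin (a + δ) ⟨by linarith, by linarith⟩
  have hmem : a - δ ∈ M := by
    refine ⟨⟨by linarith, by linarith⟩, ?_⟩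
    change f (a - δ) ≤ f a₀
    simp only [hf] at hfa hr' ⊢
    linarith
  have := csInf_le hMb hmem
  linarith

end Chord

/-! ### The chain distance and its continuity -/

section ChainDist

variable {ι E : Type*} [PseudoMetricSpace E]

/-- The infimum of the lengths of the chains with at most `N` edges that start at `v` and have their
last edge in `T i`. -/
noncomputable def chainDist (T : ι → Set E) (v : E) (N : ℕ) (i : ι) (z : E) : ℝ :=
  sInf {r | ∃ k ≤ N, FlatChain T v k i z r}

theorem bddBelow_chain (T : ι → Set E) (v : E) (N : ℕ) (i : ι) (z : E) :
    BddBelow {r | ∃ k ≤ N, FlatChain T v k i z r} :=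
  ⟨0, fun _ ⟨_, _, h⟩ => dist_nonneg.trans h.dist_le⟩

theorem chainDist_le {T : ι → Set E} {v : E} {N k : ℕ} (hk : k ≤ N) {i : ι} {z : E} {r : ℝ}
    (h : FlatChain T v k i z r) : chainDist T v N i z ≤ r :=
  csInf_le (bddBelow_chain T v N i z) ⟨k, hk, h⟩

theorem chainDist_nonneg (T : ι → Set E) (v : E) (N : ℕ) (i : ι) (z : E) :
    0 ≤ chainDist T v N i z :=
  Real.sInf_nonneg fun _ ⟨_, _, h⟩ => dist_nonneg.trans h.dist_le

/-- Moving the end of the last edge inside `T i` costs at most the distance moved, so the chain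
distance is 1-Lipschitz there. -/
theorem continuousOn_chainDist {T : ι → Set E} {v : E} {N : ℕ} {i : ι}
    (hne : ∀ z ∈ T i, ∃ k ≤ N, ∃ r, FlatChain T v k i z r) :
    ContinuousOn (chainDist T v N i) (T i) := by
  refine (LipschitzOnWith.of_le_add fun z hz z' hz' => ?_ :
    LipschitzOnWith 1 (chainDist T v N i) (T i)).continuousOn
  rw [← sub_le_iff_le_add]
  obtain ⟨k, hk, r, hr⟩ := hne z' hz'
  refine le_csInf ⟨r, k, hk, hr⟩ ?_
  rintro r ⟨k, hk, hr⟩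
  obtain ⟨r', hr', hle⟩ := hr.move_last hz
  have := chainDist_le hk hr'
  rw [dist_comm]
  linarith

end ChainDist

/-! ### Comparison with the distance from the source image -/

section Comparison

variable {ι E : Type*} [NormedAddCommGroup E] [InnerProductSpace ℝ E]

/-- Where no other hyperplane passes, the chain distance has a Euclidean distance as a local upper
barrier. -/
theorem exists_barrier_chainDist [Finite ι] [FiniteDimensional ℝ E] {l : ι → E →L[ℝ] ℝ} {c : ι → ℝ}
    {T : ι → Set E} (hT : ∀ i, T i = {z | l i z = c i}) {v : E} {N : ℕ} {i : ι} {z : E}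
    (hz : ∀ j, z ∈ T j → T j = T i) (hne : ∃ k ≤ N, ∃ r, FlatChain T v k i z r) :
    ∃ ν, chainDist T v N i z = dist ν z ∧ ∀ᶠ p in 𝓝[T i] z, chainDist T v N i p ≤ dist ν p := by
  have hcl : ∀ i, IsClosed (T i) := fun i => by
    rw [hT]; exact isClosed_eq (l i).continuous continuous_const
  have : ProperSpace E := FiniteDimensional.proper ℝ E
  obtain ⟨k₀, hk₀, r₀, hr₀⟩ := hne
  obtain ⟨k, hk, j, r, hr, ht, hmin⟩ := exists_tight_chain hcl ⟨k₀, hk₀, i, r₀, hr₀⟩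
  have hji := hz j hr.mem
  obtain ⟨ν, -, hν, hev⟩ := (hr.congr_last hji).exists_barrier hT ht
  refine ⟨ν, ?_, ?_⟩
  · rw [hν]
    refine le_antisymm (chainDist_le hk (hr.congr_last hji)) (le_csInf ⟨r₀, k₀, hk₀, hr₀⟩ ?_)
    rintro r' ⟨k', hk', h'⟩
    exact hmin k' hk' i r' h'
  · filter_upwards [hev] with p ⟨r', hr', hle⟩
    exact (chainDist_le hk hr').trans hle

/-- Comparison: if the distance from `ν` bounds the chain distance from `v` near a point `x` of the
convex set `F`, with equality at `x`, then it bounds it on `F`. -/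
theorem chainDist_le_dist [Finite ι] [FiniteDimensional ℝ E] {l : ι → E →L[ℝ] ℝ} {c : ι → ℝ}
    {T : ι → Set E} (hT : ∀ i, T i = {z | l i z = c i}) {v : E} {N : ℕ} {i : ι} {F : Set E}
    (hF : Convex ℝ F) (hFT : F ⊆ T i) (hFl : ∀ j, ∀ z ∈ F, l j z ≤ c j) {o : E} (ho : o ∈ F)
    (hoT : ∀ j, o ∈ T j → T j = T i) {x w ν : E} (hx : x ∈ F) (hw : w ∈ F)
    (hup : ∀ᶠ z in 𝓝[F] x, ∃ k ≤ N, ∃ r, FlatChain T v k i z r ∧ r ≤ dist ν z)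
    (hlow : ∀ k r, FlatChain T v k i x r → dist ν x ≤ r) :
    chainDist T v N i w ≤ dist ν w := by
  have hne : ∀ z ∈ T i, ∃ k ≤ N, ∃ r, FlatChain T v k i z r := by
    intro z hz
    obtain ⟨k, hk, r, hr, -⟩ := hup.self_of_nhdsWithin hx
    obtain ⟨r', hr', -⟩ := hr.move_last hz
    exact ⟨k, hk, r', hr'⟩
  set D := chainDist T v N i with hD
  have hDc : ContinuousOn D (T i) := continuousOn_chainDist hne
  set H : E → ℝ := fun z => D z ^ 2 - ‖z‖ ^ 2 with hH
  have hHc : ContinuousOn H F :=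
    ((hDc.mono hFT).pow 2).sub (continuous_norm.pow 2).continuousOn
  have hline : ∀ {a b : E}, a ∈ F → b ∈ F → ∀ s ∈ Set.Icc (0 : ℝ) 1, AffineMap.lineMap a b s ∈ F :=
    fun ha hb s hs => hF.lineMap_mem ha hb hs
  -- A hyperplane `T j` missing `o` has `o` strictly below it, hence also every point obtained by
  -- pushing a point of `F` towards `o`.
  have hregular : ∀ z ∈ F, ∀ ε ∈ Set.Ioc (0 : ℝ) 1, ∀ j, AffineMap.lineMap z o ε ∈ T j →
      T j = T i := by
    intro z hz ε hε j hj
    refine hoT j ?_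
    rw [hT] at hj ⊢
    simp only [Set.mem_ofPred_eq, AffineMap.lineMap_apply_module, map_add, map_smul, smul_eq_mul] at hj ⊢
    have h1 := hFl j z hz
    have h2 := hFl j o ho
    by_contra h3
    have h4 : l j o < c j := lt_of_le_of_ne h2 h3
    nlinarith [mul_pos hε.1 (sub_pos.2 h4), mul_nonneg (sub_nonneg.2 hε.2) (sub_nonneg.2 h1)]
  have hconc : ∀ a ∈ F, ∀ b ∈ F, (∀ s ∈ Set.Icc (0 : ℝ) 1, ∀ j, AffineMap.lineMap a b s ∈ T j →
      T j = T i) → ∀ s ∈ Set.Icc (0 : ℝ) 1,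
      (1 - s) * H a + s * H b ≤ H (AffineMap.lineMap a b s) := by
    intro a ha b hb hreg s hs
    have hcont : Continuous fun s : ℝ => AffineMap.lineMap (k := ℝ) a b s :=
      AffineMap.lineMap_continuous
    have := chord_le_of_affine_barrier (g := fun s => H (AffineMap.lineMap a b s))
      (hHc.comp hcont.continuousOn fun s hs => hline ha hb s hs) (fun s hs => ?_) hs
    · simpa using this
    · have hsI := Set.Ioo_subset_Icc_self hs
      have hmem := hFT (hline ha hb s hsI)
      obtain ⟨ν', hν', hev⟩ := exists_barrier_chainDist hT (hreg s hsI) (hne _ hmem)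
      -- Coefficients of `‖ν' - p‖ ^ 2 - ‖p‖ ^ 2 = ‖ν'‖ ^ 2 - 2 * inner ℝ ν' p` along `p = a + s •
      -- (b - a)`.
      refine ⟨‖ν'‖ ^ 2 - 2 * inner ℝ ν' a, - 2 * inner ℝ ν' (b - a), ?_, ?_⟩
      · simp only [hH, hD]
        rw [hν', dist_eq_norm, norm_sub_sq_real, AffineMap.lineMap_apply_module']
        simp only [inner_add_right, inner_smul_right]
        ring
      · have h1 : Tendsto (fun s' : ℝ => AffineMap.lineMap a b s') (𝓝 s)
            (𝓝[T i] (AffineMap.lineMap a b s)) := by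
          refine tendsto_nhdsWithin_iff.2 ⟨hcont.tendsto s, ?_⟩
          filter_upwards [isOpen_Ioo.mem_nhds hs] with s' hs'
          exact hFT (hline ha hb s' (Set.Ioo_subset_Icc_self hs'))
        filter_upwards [h1.eventually hev] with s' hs'
        have h2 : D (AffineMap.lineMap a b s') ^ 2 ≤ dist ν' (AffineMap.lineMap a b s') ^ 2 :=
          pow_le_pow_left₀ (chainDist_nonneg T v N i _) hs' 2
        rw [dist_eq_norm, norm_sub_sq_real] at h2
        simp only [hH]
        have h3 : inner ℝ ν' (AffineMap.lineMap a b s') = inner ℝ ν' a + s' * inner ℝ ν' (b - a) := by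
          rw [AffineMap.lineMap_apply_module', inner_add_right, inner_smul_right]
          ring
        rw [h3] at h2
        linarith
  -- The segment from `x` to `w` may lie in other hyperplanes, so it is pushed towards `o` and the
  -- push tends to zero.
  have hconc' : ∀ s ∈ Set.Icc (0 : ℝ) 1,
      (1 - s) * H x + s * H w ≤ H (AffineMap.lineMap x w s) := by
    intro s hs
    have hlim : ∀ z ∈ F, Tendsto (fun ε : ℝ => H (AffineMap.lineMap z o ε)) (𝓝[>] 0) (𝓝 (H z)) := by
      intro z hz
      refine (hHc z hz).tendsto.comp (tendsto_nhdsWithin_iff.2 ⟨?_, ?_⟩)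
      · have : Continuous fun s : ℝ => AffineMap.lineMap (k := ℝ) z o s := AffineMap.lineMap_continuous
        simpa using (this.tendsto 0).mono_left nhdsWithin_le_nhds
      · filter_upwards [Ioc_mem_nhdsGT (zero_lt_one' ℝ)] with ε hε
        exact hline hz ho ε ⟨hε.1.le, hε.2⟩
    refine le_of_tendsto_of_tendsto (((hlim x hx).const_mul (1 - s)).add ((hlim w hw).const_mul s))
      (hlim _ (hline hx hw s hs)) ?_
    filter_upwards [Ioc_mem_nhdsGT (zero_lt_one' ℝ)] with ε hε
    have hεI : ε ∈ Set.Icc (0 : ℝ) 1 := ⟨hε.1.le, hε.2⟩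
    have hswap : ∀ s : ℝ, AffineMap.lineMap (AffineMap.lineMap x o ε) (AffineMap.lineMap w o ε) s =
        AffineMap.lineMap (k := ℝ) (AffineMap.lineMap x w s) o ε := by
      intro s
      simp only [AffineMap.lineMap_apply_module]
      module
    have := hconc _ (hline hx ho ε hεI) _ (hline hw ho ε hεI) (fun s hs j hj => by
      rw [hswap] at hj
      exact hregular _ (hline hx hw s hs) ε hε j hj) s hs
    rwa [hswap] at this
  have hlim : Tendsto (fun s : ℝ => AffineMap.lineMap x w s) (𝓝[>] 0) (𝓝[F] x) := by
    refine tendsto_nhdsWithin_iff.2 ⟨?_, ?_⟩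
    · have : Continuous fun s : ℝ => AffineMap.lineMap (k := ℝ) x w s := AffineMap.lineMap_continuous
      simpa using (this.tendsto 0).mono_left nhdsWithin_le_nhds
    · filter_upwards [Ioc_mem_nhdsGT (zero_lt_one' ℝ)] with s hs
      exact hline hx hw s ⟨hs.1.le, hs.2⟩
  obtain ⟨s, ⟨k, hk, r, hr, hle⟩, hs⟩ :=
    ((hlim.eventually hup).and (Ioc_mem_nhdsGT (zero_lt_one' ℝ))).exists
  have h1 := hconc' s ⟨hs.1.le, hs.2⟩
  have h2 : D (AffineMap.lineMap x w s) ^ 2 ≤ dist ν (AffineMap.lineMap x w s) ^ 2 :=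
    pow_le_pow_left₀ (chainDist_nonneg T v N i _) ((chainDist_le hk hr).trans hle) 2
  have h3 : dist ν x ^ 2 ≤ D x ^ 2 := by
    refine pow_le_pow_left₀ dist_nonneg ?_ 2
    obtain ⟨k, hk, r, hr⟩ := hne x (hFT hx)
    exact le_csInf ⟨r, k, hk, hr⟩ fun r' ⟨k', _, h'⟩ => hlow k' r' h'
  refine le_of_sq_le_sq ?_ dist_nonneg
  have h4 : inner ℝ ν (AffineMap.lineMap x w s) = (1 - s) * inner ℝ ν x + s * inner ℝ ν w := by
    rw [AffineMap.lineMap_apply_module, inner_add_right, inner_smul_right, inner_smul_right]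
  rw [dist_eq_norm, norm_sub_sq_real] at h2 h3 ⊢
  rw [h4] at h2
  simp only [hH] at h1
  -- With `A p = ‖ν‖ ^ 2 - 2 * inner ℝ ν p`, concavity gives `(1 - s) * H x + s * H w ≤ (1 - s) * A
  -- x + s * A w`, and `A x ≤ H x` cancels the first terms.
  have h5 : s * (D w ^ 2) ≤ s * (‖ν‖ ^ 2 - 2 * inner ℝ ν w + ‖w‖ ^ 2) := by
    nlinarith [mul_le_mul_of_nonneg_left h3 (sub_nonneg.2 hs.2)]
  exact le_of_mul_le_mul_left h5 hs.1

end Comparison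

/-! ### Geodesic distance and projection of chains to the boundary -/

section GeodesicDist

variable {d : ℕ}

theorem pathLength_symm {a b : Amb d} (γ : Path a b) : pathLength γ.symm = pathLength γ := by
  have h := eVariationOn.comp_eq_of_antitoneOn (γ : unitInterval → Amb d) (t := Set.univ)
    unitInterval.symm fun s _ t _ hst => unitInterval.symm_le_symm.2 hst
  rw [Set.image_univ, unitInterval.symm_bijective.surjective.range_eq] at h
  exact h

theorem geodesicDist_comm (S : Set (Amb d)) (a b : Amb d) :
    geodesicDist S a b = geodesicDist S b a := by
  have key : ∀ a b : Amb d, geodesicDist S a b ≤ geodesicDist S b a := fun a b => by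
    refine le_iInf₂ fun γ hγ => ?_
    rw [← pathLength_symm]
    exact iInf₂_le γ.symm fun s => hγ _
  exact le_antisymm (key a b) (key b a)

theorem pathLength_trans {a b c : Amb d} (γ : Path a b) (γ' : Path b c) :
    pathLength (γ.trans γ') = pathLength γ + pathLength γ' := by
  set m : unitInterval := ⟨1 / 2, by norm_num, by norm_num⟩ with hm
  have huniv : (Set.univ : Set unitInterval) = Set.Icc 0 m ∪ Set.Icc m 1 := by
    ext s
    exact ⟨fun _ => (le_total s m).imp (fun h => ⟨unitInterval.nonneg s, h⟩)
      fun h => ⟨h, unitInterval.le_one s⟩, fun _ => trivial⟩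
  set φ : unitInterval → unitInterval := fun s => ⟨s / 2, by
    constructor <;> linarith [s.2.1, s.2.2]⟩ with hφ
  set ψ : unitInterval → unitInterval := fun s => ⟨(s + 1) / 2, by
    constructor <;> linarith [s.2.1, s.2.2]⟩ with hψ
  have hφm : MonotoneOn φ Set.univ := fun s _ t _ h => by
    have h : (s : ℝ) ≤ t := h
    change (s : ℝ) / 2 ≤ t / 2
    linarith
  have hψm : MonotoneOn ψ Set.univ := fun s _ t _ h => by
    have h : (s : ℝ) ≤ t := h
    change ((s : ℝ) + 1) / 2 ≤ (t + 1) / 2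
    linarith
  have hφi : φ '' Set.univ = Set.Icc 0 m := by
    ext s
    simp only [Set.image_univ, Set.mem_range, Set.mem_Icc]
    constructor
    · rintro ⟨t, rfl⟩
      exact ⟨unitInterval.nonneg _, by
        change (t : ℝ) / 2 ≤ 1 / 2
        linarith [t.2.2]⟩
    · rintro ⟨h0, h1⟩
      have h1 : (s : ℝ) ≤ 1 / 2 := h1
      exact ⟨⟨2 * s, by linarith [s.2.1], by linarith⟩, Subtype.ext (by simp [hφ])⟩
  have hψi : ψ '' Set.univ = Set.Icc m 1 := by
    ext s
    simp only [Set.image_univ, Set.mem_range, Set.mem_Icc]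
    constructor
    · rintro ⟨t, rfl⟩
      exact ⟨by
        change (1 : ℝ) / 2 ≤ (t + 1) / 2
        linarith [t.2.1], unitInterval.le_one _⟩
    · rintro ⟨h0, h1⟩
      have h0 : 1 / 2 ≤ (s : ℝ) := h0
      exact ⟨⟨2 * s - 1, by linarith, by linarith [s.2.2]⟩, Subtype.ext (by simp [hψ])⟩
  have h1 : (γ.trans γ') ∘ φ = γ := by
    ext1 s
    have : (s : ℝ) / 2 ≤ 1 / 2 := by linarith [s.2.2]
    simp only [Function.comp_apply, Path.trans_apply, hφ, this, dif_pos]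
    congr 1
    exact Subtype.ext (by simp; ring)
  have h2 : (γ.trans γ') ∘ ψ = γ' := by
    ext1 s
    simp only [Function.comp_apply, Path.trans_apply, hψ]
    split_ifs with h
    · have hs : s = 0 := Subtype.ext (le_antisymm (by
        change (s : ℝ) ≤ 0
        linarith) s.2.1)
      subst hs
      simp
    · congr 1
      exact Subtype.ext (by simp; ring)
  have hgr : IsGreatest (Set.Icc 0 m) m := ⟨⟨unitInterval.nonneg m, le_rfl⟩, fun s h => h.2⟩
  have hle : IsLeast (Set.Icc m 1) m := ⟨⟨le_rfl, unitInterval.le_one m⟩, fun s h => h.1⟩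
  rw [pathLength, huniv, eVariationOn.union _ hgr hle, ← hφi, ← hψi,
    ← eVariationOn.comp_eq_of_monotoneOn _ φ hφm, ← eVariationOn.comp_eq_of_monotoneOn _ ψ hψm, h1, h2]
  rfl

theorem geodesicDist_triangle (S : Set (Amb d)) (a b c : Amb d) :
    geodesicDist S a c ≤ geodesicDist S a b + geodesicDist S b c := by
  unfold geodesicDist
  simp only [ENNReal.iInf_add, ENNReal.add_iInf]
  refine le_iInf₂ fun γ hγ => le_iInf₂ fun γ' hγ' => ?_
  rw [← pathLength_trans]
  refine iInf₂_le (γ'.trans γ) fun s => ?_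
  have : (γ'.trans γ) s ∈ Set.range (γ'.trans γ) := ⟨s, rfl⟩
  rw [Path.trans_range] at this
  rcases this with ⟨t, ht⟩ | ⟨t, ht⟩
  · exact ht ▸ hγ' t
  · exact ht ▸ hγ t

/-- The geodesic distance of the ends of the image of a segment under a map that does not increase
distances is at most the length of the segment. -/
theorem geodesicDist_le_of_lipschitz {S : Set (Amb d)} {π : Amb d → Amb d} (hπ : LipschitzWith 1 π)
    {a b : Amb d} (hS : ∀ z ∈ segment ℝ a b, π z ∈ S) : geodesicDist S (π a) (π b) ≤ edist a b := by
  set f : unitInterval → Amb d := fun s => AffineMap.lineMap a b (s : ℝ) with hf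
  have hfc : Continuous f := AffineMap.lineMap_continuous.comp continuous_subtype_val
  let γ : Path (π a) (π b) :=
    { toFun := fun s => π (f s)
      continuous_toFun := hπ.continuous.comp hfc
      source' := by simp [hf]
      target' := by simp [hf] }
  refine (iInf₂_le γ fun s => hS _ ?_).trans ?_
  · rw [segment_eq_image_lineMap]
    exact ⟨s, s.2, rfl⟩
  have hlip : LipschitzOnWith (nndist a b) (fun s : ℝ => AffineMap.lineMap (k := ℝ) a b s) Set.univ :=
    (lipschitzWith_lineMap (𝕜 := ℝ) a b).lipschitzOnWith
  have hlip2 : LipschitzOnWith (1 * nndist a b) (fun s : ℝ => π (AffineMap.lineMap (k := ℝ) a b s)) Set.univ :=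
    (hπ.lipschitzOnWith (s := Set.univ)).comp hlip (Set.mapsTo_univ _ _)
  have h1 : pathLength γ ≤ eVariationOn (fun s : ℝ => π (AffineMap.lineMap (k := ℝ) a b s)) (Set.Icc 0 1) :=
    eVariationOn.comp_le_of_monotoneOn (fun s : ℝ => π (AffineMap.lineMap (k := ℝ) a b s))
      (Subtype.val : unitInterval → ℝ) (fun s _ t _ h => h) (fun s _ => s.2)
  have h2 := hlip2.comp_eVariationOn_le (f := fun s : ℝ => π (AffineMap.lineMap (k := ℝ) a b s))
    (g := id) (s := Set.Icc (0 : ℝ) 1) (Set.mapsTo_univ _ _)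
  rw [Function.comp_id, eVariationOn_id_Icc] at h2
  refine h1.trans (h2.trans ?_)
  rw [sub_zero, ENNReal.ofReal_one, mul_one, one_mul, edist_nndist]

/-- The nearest point map of a nonempty closed convex set. -/
theorem exists_nearest_point_map {E : Type*} [NormedAddCommGroup E] [InnerProductSpace ℝ E]
    [CompleteSpace E] {P : Set E} (hne : P.Nonempty) (hcl : IsClosed P) (hc : Convex ℝ P) :
    ∃ π : E → E, LipschitzWith 1 π ∧ (∀ z, π z ∈ P) ∧ (∀ z ∈ P, π z = z) ∧
      ∀ z, z ∉ interior P → π z ∈ frontier P := by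
  have hex : ∀ z, ∃ p ∈ P, ∀ y ∈ P, inner ℝ (z - p) (y - p) ≤ 0 := fun z => by
    obtain ⟨p, hp, h⟩ := exists_norm_eq_iInf_of_complete_convex hne hcl.isComplete hc z
    exact ⟨p, hp, (norm_eq_iInf_iff_real_inner_le_zero hc hp).1 h⟩
  choose π hπP hπ using hex
  have hfix : ∀ z ∈ P, π z = z := fun z hz => by
    have := hπ z z hz
    rw [real_inner_self_nonpos, sub_eq_zero] at this
    exact this.symm
  refine ⟨π, LipschitzWith.of_dist_le_mul fun a b => ?_, hπP, hfix, fun z hz => ?_⟩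
  · have h1 := hπ a (π b) (hπP b)
    have h2 := hπ b (π a) (hπP a)
    -- Sum of the variational inequalities at `a` and `b`, each tested with the other projection;
    -- Cauchy–Schwarz then gives the Lipschitz bound.
    have h3 : ‖π a - π b‖ ^ 2 ≤ inner ℝ (a - b) (π a - π b) := by
      rw [← real_inner_self_eq_norm_sq]
      have e : inner ℝ (a - b) (π a - π b) - inner ℝ (π a - π b) (π a - π b) =
          -(inner ℝ (a - π a) (π b - π a) + inner ℝ (b - π b) (π a - π b)) := by
        simp only [inner_sub_left, inner_sub_right]
        ring
      linarith
    have h4 := h3.trans (real_inner_le_norm _ _)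
    rw [dist_eq_norm, dist_eq_norm, NNReal.coe_one, one_mul]
    by_contra! h5
    have h6 : 0 < ‖π a - π b‖ := (norm_nonneg _).trans_lt h5
    nlinarith
  · rw [hcl.frontier_eq]
    refine ⟨hπP z, fun hint => ?_⟩
    -- From an interior projection one could step towards `z` inside `P`; the variational inequality
    -- then forces `z = π z`, which is interior.
    have hcont : Tendsto (fun ε : ℝ => π z + ε • (z - π z)) (𝓝[>] 0) (𝓝 (π z)) := by
      have : Continuous fun ε : ℝ => π z + ε • (z - π z) := by fun_prop
      simpa using (this.tendsto 0).mono_left nhdsWithin_le_nhds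
    obtain ⟨ε, hε, hpos⟩ := ((hcont.eventually_mem (mem_interior_iff_mem_nhds.1 hint)).and
      self_mem_nhdsWithin).exists
    have h1 := hπ z _ hε
    rw [add_sub_cancel_left, inner_smul_right, real_inner_self_eq_norm_sq] at h1
    have hpos : 0 < ε := hpos
    have h2 : ‖z - π z‖ = 0 := by
      have : ‖z - π z‖ ^ 2 ≤ 0 := by
        by_contra! h
        nlinarith [mul_pos hpos h]
      exact pow_eq_zero_iff two_ne_zero |>.1 (le_antisymm this (sq_nonneg _))
    rw [norm_eq_zero, sub_eq_zero] at h2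
    rw [← h2] at hint
    exact hz hint

/-- A nonzero functional increases in some direction, so an interior point could be pushed past the
level `c`. Hence chain edges in supporting hyperplanes project into the boundary. -/
theorem notMem_interior_of_isMaxOn {E : Type*} [NormedAddCommGroup E] [NormedSpace ℝ E] {P : Set E}
    {l : E →L[ℝ] ℝ} (hl : l ≠ 0) {c : ℝ} (hP : ∀ z ∈ P, l z ≤ c) {z : E} (hz : l z = c) :
    z ∉ interior P := by
  intro hint
  obtain ⟨u, hu⟩ : ∃ u, l u ≠ 0 := by
    by_contra! h
    exact hl (ContinuousLinearMap.ext h)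
  have key : ∀ u, 0 < l u → False := by
    intro u hu
    have hcont : Tendsto (fun ε : ℝ => z + ε • u) (𝓝[>] 0) (𝓝 z) := by
      have : Continuous fun ε : ℝ => z + ε • u := by fun_prop
      simpa using (this.tendsto 0).mono_left nhdsWithin_le_nhds
    obtain ⟨ε, hε, hpos⟩ := ((hcont.eventually_mem (mem_interior_iff_mem_nhds.1 hint)).and
      self_mem_nhdsWithin).exists
    have h1 := hP _ hε
    rw [map_add, map_smul, smul_eq_mul, hz] at h1
    have hpos : 0 < ε := hpos
    nlinarith [mul_pos hpos hu]
  rcases lt_or_gt_of_ne hu with h | h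
  · exact key (-u) (by simpa using h)
  · exact key u h

/-- A chain in supporting hyperplanes of `P` with ends in `P` is at least as long as the geodesic
distance in the boundary of `P`. -/
theorem FlatChain.geodesicDist_le {ι : Type*} {P : Set (Amb d)} (hcl : IsClosed P) (hc : Convex ℝ P)
    {l : ι → Amb d →L[ℝ] ℝ} {c : ι → ℝ} {T : ι → Set (Amb d)} (hl : ∀ i, l i ≠ 0)
    (hT : ∀ i, T i = {z | l i z = c i}) (hP : ∀ i, ∀ z ∈ P, l i z ≤ c i)
    {v z : Amb d} (hv : v ∈ P) (hz : z ∈ P) {k : ℕ} {i : ι} {r : ℝ} (h : FlatChain T v k i z r) :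
    geodesicDist (frontier P) v z ≤ ENNReal.ofReal r := by
  obtain ⟨π, hπ, -, hfix, hfr⟩ := exists_nearest_point_map ⟨v, hv⟩ hcl hc
  have hedge : ∀ i, ∀ a ∈ T i, ∀ b ∈ T i, geodesicDist (frontier P) (π a) (π b) ≤ edist a b := by
    intro i a ha b hb
    refine geodesicDist_le_of_lipschitz hπ fun y hy => hfr _ ?_
    have hconv : Convex ℝ (T i) := by
      rw [hT]; exact convex_hyperplane (l i).toLinearMap.isLinear _
    have hyT := hconv.segment_subset ha hb hy
    rw [hT] at hyT
    exact notMem_interior_of_isMaxOn (hl i) (hP i) hyT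
  -- Intermediate vertices may lie outside `P`, so the induction has to speak of projected points.
  suffices geodesicDist (frontier P) (π v) (π z) ≤ ENNReal.ofReal r by
    rwa [hfix v hv, hfix z hz] at this
  clear hz
  induction h with
  | single h1 h2 =>
    rw [← edist_dist]
    exact hedge _ _ h1 _ h2
  | @snoc k i j q z r h h1 h2 ih =>
    rw [ENNReal.ofReal_add (dist_nonneg.trans h.dist_le) dist_nonneg, ← edist_dist]
    exact (geodesicDist_triangle _ _ (π q) _).trans (add_le_add ih (hedge _ _ h1 _ h2))

end GeodesicDist

/-! ### Relative interiors of convex sets -/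

section IntrinsicInterior

variable {E : Type*} [NormedAddCommGroup E] [NormedSpace ℝ E]

theorem mem_intrinsicInterior_iff_eventually {S : Set E} {o : E} :
    o ∈ intrinsicInterior ℝ S ↔
      o ∈ affineSpan ℝ S ∧ ∀ᶠ p in 𝓝[(affineSpan ℝ S : Set E)] o, p ∈ S := by
  rw [mem_intrinsicInterior]
  constructor
  · rintro ⟨y, hy, rfl⟩
    refine ⟨y.2, ?_⟩
    have := mem_interior_iff_mem_nhds.1 hy
    rw [← map_nhds_subtype_val, eventually_map]
    exact this
  · rintro ⟨ho, h⟩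
    refine ⟨⟨o, ho⟩, mem_interior_iff_mem_nhds.2 ?_, rfl⟩
    rw [← map_nhds_subtype_val (⟨o, ho⟩ : (affineSpan ℝ S : Set E)), eventually_map] at h
    exact h

/-- The homothety with centre `r` and ratio `t` carries a neighbourhood of `f` in the affine span,
contained in `S`, to one of the new point. -/
theorem Convex.combo_intrinsicInterior_mem {S : Set E} (hS : Convex ℝ S) {f r : E}
    (hf : f ∈ intrinsicInterior ℝ S) (hr : r ∈ S) {t : ℝ} (ht0 : 0 < t) (ht1 : t ≤ 1) :
    AffineMap.lineMap r f t ∈ intrinsicInterior ℝ S := by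
  rw [mem_intrinsicInterior_iff_eventually] at hf ⊢
  have hr' := subset_affineSpan ℝ S hr
  have hy := AffineMap.lineMap_mem t hr' hf.1
  refine ⟨hy, ?_⟩
  set y := AffineMap.lineMap r f t with hydef
  have hlim : Tendsto (fun p : E => t⁻¹ • (p - y) + f) (𝓝[(affineSpan ℝ S : Set E)] y)
      (𝓝[(affineSpan ℝ S : Set E)] f) := by
    refine tendsto_nhdsWithin_iff.2 ⟨?_, ?_⟩
    · have : Continuous fun p : E => t⁻¹ • (p - y) + f := by fun_prop
      simpa using (this.tendsto y).mono_left nhdsWithin_le_nhds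
    · filter_upwards [self_mem_nhdsWithin] with p hp
      exact (affineSpan ℝ S).smul_vsub_vadd_mem _ hp hy hf.1
  filter_upwards [hlim.eventually hf.2] with p hp
  have h := hS.lineMap_mem hr hp (t := t) ⟨ht0.le, ht1⟩
  convert h using 1
  rw [AffineMap.lineMap_apply_module] at hydef ⊢
  rw [hydef, smul_add, smul_smul, mul_inv_cancel₀ ht0.ne']
  module

/-- If `l z < c`, a small step from `o` away from `z` stays in `S` and raises `l` above `c`. -/
theorem eq_of_isMaxOn_intrinsicInterior {S : Set E} {o : E} (ho : o ∈ intrinsicInterior ℝ S)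
    {l : E →L[ℝ] ℝ} {c : ℝ} (hS : ∀ z ∈ S, l z ≤ c) (hoc : l o = c) : ∀ z ∈ S, l z = c := by
  intro z hz
  rw [mem_intrinsicInterior_iff_eventually] at ho
  have hlim : Tendsto (fun ε : ℝ => AffineMap.lineMap o z (-ε)) (𝓝[>] 0)
      (𝓝[(affineSpan ℝ S : Set E)] o) := by
    refine tendsto_nhdsWithin_iff.2 ⟨?_, .of_forall fun ε =>
      AffineMap.lineMap_mem _ ho.1 (subset_affineSpan ℝ S hz)⟩
    have : Continuous fun ε : ℝ => AffineMap.lineMap (k := ℝ) o z (-ε) :=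
      AffineMap.lineMap_continuous.comp continuous_neg
    simpa using (this.tendsto 0).mono_left nhdsWithin_le_nhds
  obtain ⟨ε, hε, hpos⟩ := ((hlim.eventually ho.2).and self_mem_nhdsWithin).exists
  have hpos : 0 < ε := hpos
  have h1 := hS _ hε
  rw [AffineMap.lineMap_apply_module, map_add, map_smul, map_smul, smul_eq_mul, smul_eq_mul, hoc] at h1
  refine le_antisymm (hS z hz) ?_
  by_contra! h
  nlinarith [mul_pos hpos (sub_pos.2 h)]

end IntrinsicInterior

/-! ### Supporting hyperplanes of facets, ridges and folding maps -/

section Facets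

variable {d : ℕ} {P F F' : Set (Amb d)} {l l' : Amb d →L[ℝ] ℝ} {c c' : ℝ}

/-- The hyperplane `l = c` supports `P` along the facet `F`. -/
structure SupportsFacet (P F : Set (Amb d)) (l : Amb d →L[ℝ] ℝ) (c : ℝ) : Prop where
  ne_zero : l ≠ 0
  le : ∀ z ∈ P, l z ≤ c
  eq : F = {z | z ∈ P ∧ l z = c}
  span : (affineSpan ℝ F : Set (Amb d)) = {z | l z = c}

theorem finrank_ker_of_ne_zero (hl : l ≠ 0) :
    Module.finrank ℝ (LinearMap.ker l.toLinearMap) = d := by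
  have h := Module.Dual.finrank_ker_add_one_of_ne_zero (f := l.toLinearMap)
    fun h => hl (ContinuousLinearMap.ext fun z => LinearMap.congr_fun h z)
  rw [finrank_euclideanSpace_fin] at h
  omega

theorem direction_le_ker {G : Set (Amb d)} (h : ∀ z ∈ G, l z = c) :
    (affineSpan ℝ G).direction ≤ LinearMap.ker l.toLinearMap := by
  rw [direction_affineSpan, vectorSpan_def, Submodule.span_le]
  rintro _ ⟨a, ha, b, hb, rfl⟩
  simp [h a ha, h b hb]

/-- The exposing functional is nonzero because `F ≠ P`, and its kernel has the dimension of the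
facet, so the facet spans the whole hyperplane. -/
theorem IsFacet.exists_supportsFacet (hF : IsFacet P F) : ∃ l c, SupportsFacet P F l c := by
  obtain ⟨⟨⟨p, hp⟩, hexp, hne⟩, hdim⟩ := hF
  obtain ⟨l, hl⟩ := hexp ⟨p, hp⟩
  have hp' := hp
  rw [hl] at hp'
  have hFeq : F = {z | z ∈ P ∧ l z = l p} := by
    ext z
    rw [hl]
    constructor
    · rintro ⟨h1, h2⟩
      exact ⟨h1, le_antisymm (hp'.2 z h1) (h2 p hp'.1)⟩
    · rintro ⟨h1, h2⟩
      exact ⟨h1, fun y hy => h2 ▸ hp'.2 y hy⟩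
  have hl0 : l ≠ 0 := by
    rintro rfl
    exact hne (hl.trans (by ext z; simp))
  refine ⟨l, l p, hl0, hp'.2, hFeq, ?_⟩
  have hval : ∀ z ∈ F, l z = l p := fun z hz => by
    rw [hFeq] at hz; exact hz.2
  have hdir : (affineSpan ℝ F).direction = LinearMap.ker l.toLinearMap :=
    Submodule.eq_of_le_of_finrank_eq (direction_le_ker hval)
      (hdim.trans (finrank_ker_of_ne_zero hl0).symm)
  ext z
  rw [SetLike.mem_coe, ← AffineSubspace.vsub_right_mem_direction_iff_mem (subset_affineSpan ℝ F hp),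
    hdir]
  simp [sub_eq_zero]

theorem SupportsFacet.subset (h : SupportsFacet P F l c) : F ⊆ P := fun z hz => by
  rw [h.eq] at hz; exact hz.1

theorem SupportsFacet.apply_eq (h : SupportsFacet P F l c) {z : Amb d} (hz : z ∈ F) : l z = c := by
  rw [h.eq] at hz; exact hz.2

theorem SupportsFacet.convex (h : SupportsFacet P F l c) (hP : Convex ℝ P) : Convex ℝ F := by
  rw [h.eq]
  exact hP.inter (convex_hyperplane l.toLinearMap.isLinear c)

theorem SupportsFacet.isClosed (h : SupportsFacet P F l c) (hP : IsClosed P) : IsClosed F := by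
  rw [h.eq]
  exact hP.inter (isClosed_eq l.continuous continuous_const)

/-- If the supporting hyperplane of a facet `F'` passes through a relative interior point of `F`, then
`F ⊆ F'`. -/
theorem SupportsFacet.subset_of_mem_intrinsicInterior (h : SupportsFacet P F l c) (h' : SupportsFacet P F' l' c')
    {o : Amb d} (ho : o ∈ intrinsicInterior ℝ F) (hoc : l' o = c') : F ⊆ F' := by
  have := eq_of_isMaxOn_intrinsicInterior ho (fun z hz => h'.le z (h.subset hz)) hoc
  intro z hz
  rw [h'.eq]
  exact ⟨h.subset hz, this z hz⟩

theorem IsFacet.eq_of_subset (hF : IsFacet P F) (hF' : IsFacet P F') (h : F ⊆ F') : F = F' := by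
  obtain ⟨l, c, hl⟩ := hF.exists_supportsFacet
  obtain ⟨l', c', hl'⟩ := hF'.exists_supportsFacet
  obtain ⟨p, hp⟩ := hF.1.1
  have hspan : affineSpan ℝ F = affineSpan ℝ F' := by
    refine AffineSubspace.eq_of_direction_eq_of_nonempty_of_le ?_ ⟨p, subset_affineSpan ℝ F hp⟩
      (affineSpan_mono ℝ h)
    exact Submodule.eq_of_le_of_finrank_eq (AffineSubspace.direction_le (affineSpan_mono ℝ h))
      (hF.2.trans hF'.2.symm)
  refine h.antisymm fun z hz => ?_
  rw [hl.eq]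
  refine ⟨hl'.subset hz, ?_⟩
  have : z ∈ (affineSpan ℝ F : Set (Amb d)) := by
    rw [hspan]; exact subset_affineSpan ℝ F' hz
  rwa [hl.span] at this

theorem IsRidge.not_subset (hF : IsFacet P F) (hR : IsRidge P (F ∩ F')) : ¬ F ⊆ F' := by
  intro h
  have h1 := hR.2
  rw [Set.inter_eq_left.2 h, hF.2] at h1
  omega

/-- A relative interior point of a facet is strictly below the supporting hyperplane of an adjacent
facet. -/
theorem SupportsFacet.lt_of_mem_intrinsicInterior (h : SupportsFacet P F l c)
    (h' : SupportsFacet P F' l' c') (hF : IsFacet P F) (hR : IsRidge P (F ∩ F')) {o : Amb d}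
    (ho : o ∈ intrinsicInterior ℝ F) : l' o < c' :=
  lt_of_le_of_ne (h'.le o (h.subset (intrinsicInterior_subset ho))) fun e =>
    hR.not_subset hF (h.subset_of_mem_intrinsicInterior h' ho e)

/-- The two kernels differ, as otherwise `F ⊆ F'`; so their intersection has dimension at most `d -
1`, already attained by the ridge. -/
theorem IsRidge.span_eq (hF : IsFacet P F) (h : SupportsFacet P F l c) (h' : SupportsFacet P F' l' c')
    (hR : IsRidge P (F ∩ F')) :
    (affineSpan ℝ (F ∩ F') : Set (Amb d)) = {z | l z = c ∧ l' z = c'} := by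
  obtain ⟨p, hp⟩ := hR.1.1
  have hlp := h.apply_eq hp.1
  have hlp' := h'.apply_eq hp.2
  have hlt : LinearMap.ker l.toLinearMap ⊓ LinearMap.ker l'.toLinearMap <
      LinearMap.ker l.toLinearMap := by
    refine lt_of_le_of_ne inf_le_left fun e => hR.not_subset hF fun z hz => ?_
    rw [h'.eq]
    refine ⟨h.subset hz, ?_⟩
    have h1 : z - p ∈ LinearMap.ker l.toLinearMap := by
      simp [h.apply_eq hz, hlp]
    rw [← e] at h1
    have h2 : l' (z - p) = 0 := h1.2
    rw [map_sub, hlp', sub_eq_zero] at h2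
    exact h2
  have hdir : (affineSpan ℝ (F ∩ F')).direction =
      LinearMap.ker l.toLinearMap ⊓ LinearMap.ker l'.toLinearMap := by
    refine Submodule.eq_of_le_of_finrank_le (le_inf (direction_le_ker fun z hz => h.apply_eq hz.1)
      (direction_le_ker fun z hz => h'.apply_eq hz.2)) ?_
    have h1 := Submodule.finrank_lt_finrank_of_lt hlt
    rw [finrank_ker_of_ne_zero h.ne_zero] at h1
    have h2 : Module.finrank ℝ (affineSpan ℝ (F ∩ F')).direction + 1 = d := hR.2
    omega
  ext z
  rw [SetLike.mem_coe, ← AffineSubspace.vsub_right_mem_direction_iff_mem (subset_affineSpan ℝ _ hp),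
    hdir]
  simp [sub_eq_zero, hlp, hlp']

/-- Moving from a relative interior point of a ridge to the inner side within the span of an adjacent
facet, one enters the relative interior of that facet. -/
theorem eventually_mem_intrinsicInterior_facet (hP : Convex ℝ P) (hF : IsFacet P F)
    (h : SupportsFacet P F l c) (h' : SupportsFacet P F' l' c') (hR : IsRidge P (F ∩ F'))
    {r g : Amb d} (hr : r ∈ intrinsicInterior ℝ (F ∩ F')) (hg : l g = c) (hg' : l' g < c') :
    ∀ᶠ ε in 𝓝[>] (0 : ℝ), AffineMap.lineMap r g ε ∈ intrinsicInterior ℝ F := by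
  have hFc := h.convex hP
  obtain ⟨f, hf⟩ := (intrinsicInterior_nonempty hFc).2 hF.1.1
  have hf' := h.lt_of_mem_intrinsicInterior h' hF hR hf
  have hfc := h.apply_eq (intrinsicInterior_subset hf)
  have hrR := intrinsicInterior_subset hr
  have hrc := h.apply_eq hrR.1
  have hrc' := h'.apply_eq hrR.2
  rw [mem_intrinsicInterior_iff_eventually] at hr
  -- This ratio makes `(g - r) - a • (f - r)` parallel to the ridge. The moving point is then a
  -- combination, with weight `ε * a` on `f`, of `f` and a point `q ε` of the ridge near `r`.
  set a := (c' - l' g) / (c' - l' f) with ha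
  have hfpos : 0 < c' - l' f := sub_pos.2 hf'
  have hapos : 0 < a := div_pos (sub_pos.2 hg') hfpos
  have haf : a * (c' - l' f) = c' - l' g := div_mul_cancel₀ _ hfpos.ne'
  set q : ℝ → Amb d := fun ε => (1 - ε * a)⁻¹ • (ε • (g - r) - (ε * a) • (f - r)) + r with hq
  have hlim : Tendsto q (𝓝[>] 0) (𝓝[(affineSpan ℝ (F ∩ F') : Set (Amb d))] r) := by
    refine tendsto_nhdsWithin_iff.2 ⟨?_, .of_forall fun ε => ?_⟩
    · have : ContinuousAt q 0 := by
        have : ContinuousAt (fun ε : ℝ => (1 - ε * a)⁻¹) 0 :=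
          ContinuousAt.inv₀ (by fun_prop) (by simp)
        fun_prop
      simpa [hq] using this.tendsto.mono_left nhdsWithin_le_nhds
    · rw [hR.span_eq hF h h']
      simp only [Set.mem_ofPred_eq, hq, map_add, map_smul, map_sub, smul_eq_mul, hg, hfc, hrc, hrc']
      refine ⟨by ring, ?_⟩
      rw [show ε * (l' g - c') - ε * a * (l' f - c') = ε * (a * (c' - l' f) - (c' - l' g)) by ring, haf]
      ring
  have hsmall : ∀ᶠ ε in 𝓝[>] (0 : ℝ), ε * a < 1 := by
    have : Continuous fun ε : ℝ => ε * a := by fun_prop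
    have h1 : Tendsto (fun ε : ℝ => ε * a) (𝓝[>] 0) (𝓝 0) := by
      simpa using (this.tendsto 0).mono_left nhdsWithin_le_nhds
    exact h1.eventually (gt_mem_nhds one_pos)
  filter_upwards [hlim.eventually hr.2, hsmall, self_mem_nhdsWithin] with ε hε h1 hpos
  have hpos : 0 < ε := hpos
  have := hFc.combo_intrinsicInterior_mem hf hε.1 (mul_pos hpos hapos) h1.le
  convert this using 1
  simp only [AffineMap.lineMap_apply_module, hq]
  have h2 : 1 - ε * a ≠ 0 := by linarith
  rw [smul_add, smul_smul, mul_inv_cancel₀ h2]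
  module

theorem IsometryEquiv.apply_lineMap (Φ : Amb d ≃ᵢ Amb d) (a b : Amb d) (t : ℝ) :
    Φ (AffineMap.lineMap a b t) = AffineMap.lineMap (Φ a) (Φ b) t :=
  Φ.toRealAffineIsometryEquiv.toAffineEquiv.toAffineMap.apply_lineMap a b t

/-- A bijective isometry is affine (Mazur–Ulam), so its fixed points form an affine subspace. -/
theorem IsFoldingMap.fix_span {Φ : Amb d ≃ᵢ Amb d} (hΦ : IsFoldingMap F F' Φ) {p : Amb d}
    (hp : p ∈ affineSpan ℝ (F ∩ F')) : Φ p = p := by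
  refine affineSpan_induction (p := fun p => Φ p = p) hp hΦ.fix_ridge fun t u v w hu hv hw => ?_
  have h1 := Φ.toRealAffineIsometryEquiv.map_vadd w (t • (u -ᵥ v))
  rw [map_smul, Φ.toRealAffineIsometryEquiv.map_vsub] at h1
  simp only [IsometryEquiv.coeFn_toRealAffineIsometryEquiv, hu, hv, hw] at h1
  exact h1

/-- A folding map exchanges the sides of the ridge: what lands on the side of `F'` comes from beyond
the ridge. -/
theorem IsFoldingMap.lt_of_lt {Φ : Amb d ≃ᵢ Amb d} (hΦ : IsFoldingMap F F' Φ) (hP : Convex ℝ P)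
    (hF : IsFacet P F) (hF' : IsFacet P F') (h : SupportsFacet P F l c)
    (h' : SupportsFacet P F' l' c') (hR : IsRidge P (F ∩ F')) {a : Amb d} (ha : l a = c)
    (hb' : l' (Φ a) = c') (hb : l (Φ a) < c) : c' < l' a := by
  by_contra! hle
  rcases hle.eq_or_lt with he | hlt
  · have : a ∈ (affineSpan ℝ (F ∩ F') : Set (Amb d)) := by
      rw [hR.span_eq hF h h']; exact ⟨ha, he⟩
    rw [hΦ.fix_span this, ha] at hb
    exact lt_irrefl _ hb
  · have hRc : Convex ℝ (F ∩ F') := (h.convex hP).inter (h'.convex hP)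
    obtain ⟨r, hr⟩ := (intrinsicInterior_nonempty hRc).2 hR.1.1
    have hR' : IsRidge P (F' ∩ F) := by rwa [Set.inter_comm]
    -- If `a` were on the inner side, a short piece of the segment from `r` to `a` would enter `F`
    -- while its image enters the relative interior of `F'`, against disjointness.
    have h1 := eventually_mem_intrinsicInterior_facet hP hF h h' hR hr ha hlt
    have h2 := eventually_mem_intrinsicInterior_facet hP hF' h' h hR'
      (by rwa [Set.inter_comm]) hb' hb
    obtain ⟨ε, hε1, hε2⟩ := (h1.and h2).exists
    refine Set.disjoint_left.1 hΦ.disjoint_interior ⟨_, intrinsicInterior_subset hε1, rfl⟩ ?_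
    rw [IsometryEquiv.apply_lineMap, hΦ.fix_ridge r (intrinsicInterior_subset hr)]
    exact hε2

end Facets

/-! ### Shortest paths are polygons, and their unfolding -/

section ShortestPaths

variable {d : ℕ} {P : Set (Amb d)}

theorem IsConvexPolyhedron.isClosed (hP : IsConvexPolyhedron P) : IsClosed P := by
  obtain ⟨⟨H, -, -, rfl⟩, -⟩ := hP
  simp only [Set.ofPred_forall]
  exact isClosed_biInter fun h _ => isClosed_le (by fun_prop) continuous_const

theorem IsConvexPolyhedron.convex (hP : IsConvexPolyhedron P) : Convex ℝ P := by
  obtain ⟨⟨H, -, -, rfl⟩, -⟩ := hP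
  simp only [Set.ofPred_forall]
  exact convex_iInter₂ fun h _ => convex_halfSpace_le (innerₗ _ h.1).isLinear _

theorem SupportsFacet.subset_frontier {F : Set (Amb d)} {l : Amb d →L[ℝ] ℝ} {c : ℝ}
    (h : SupportsFacet P F l c) : F ⊆ frontier P := fun _ hz =>
  ⟨subset_closure (h.subset hz), notMem_interior_of_isMaxOn h.ne_zero h.le (h.apply_eq hz)⟩

/-- Dividing times of a path that traverses facets, with the closed pieces in the facets. -/
theorem Traverses.exists_monotone_times (hP : IsClosed P) {x v : Amb d} {γ : Path x v} {n : ℕ}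
    {L : ℕ → Set (Amb d)} (h : Traverses P γ n L) :
    ∃ t : ℕ → unitInterval, Monotone t ∧ t 0 = 0 ∧ t (n + 1) = 1 ∧
      (∀ i ≤ n, ∀ s ∈ Set.Icc (t i) (t (i + 1)), γ s ∈ L i) ∧
      ∀ i, 1 ≤ i → i ≤ n → ∃ s ∈ Set.Icc (t i) (t (i + 1)), γ s ∈ intrinsicInterior ℝ (L i) := by
  obtain ⟨t, ht0, ht1, hlt, hint⟩ := h.times
  have hle : ∀ i ≤ n, t i ≤ t (i + 1) := by
    intro i hi
    rcases Nat.eq_zero_or_pos i with rfl | h0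
    · rw [ht0]; exact unitInterval.nonneg _
    · exact (hlt i h0 hi).le
  have hmin : ∀ i ≤ n, min i (n + 1) = i ∧ min (i + 1) (n + 1) = i + 1 := fun i hi => by omega
  -- Times are frozen after index `n + 1`, so that the sequence is monotone on all of `ℕ`.
  refine ⟨fun i => t (min i (n + 1)), monotone_nat_of_le_succ fun i => ?_, by simpa using ht0,
    by simpa using ht1, fun i hi => ?_, fun i h0 hi => ?_⟩
  · rcases le_or_gt i n with hi | hi
    · simpa only [(hmin i hi).1, (hmin i hi).2] using hle i hi
    · rw [show min i (n + 1) = n + 1 by omega, show min (i + 1) (n + 1) = n + 1 by omega]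
  · simp only [(hmin i hi).1, (hmin i hi).2]
    intro s hs
    rcases (hle i hi).eq_or_lt with he | hl
    · have hi0 : i = 0 := by
        by_contra h0
        exact (hlt i (Nat.pos_of_ne_zero h0) hi).ne he
      subst hi0
      rw [← he, Set.Icc_self, Set.mem_singleton_iff, ht0] at hs
      rw [hs, γ.source]
      exact h.start_mem
    · obtain ⟨l, c, hs'⟩ := (h.facet i hi).exists_supportsFacet
      have hcl : IsClosed (γ ⁻¹' L i) := (hs'.isClosed hP).preimage γ.continuous
      rw [← closure_Ioo hl.ne] at hs
      refine closure_minimal (fun s hs => ?_) hcl hs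
      exact Set.mem_preimage.2 (intrinsicInterior_subset (hint i hi s hs.1 hs.2))
  · simp only [(hmin i hi).1, (hmin i hi).2]
    obtain ⟨s, hs1, hs2⟩ := exists_between (hlt i h0 hi)
    exact ⟨s, ⟨hs1.le, hs2.le⟩, hint i hi s hs1 hs2⟩

theorem geodesicDist_le_sum {S : Set (Amb d)} {q : ℕ → Amb d} (m : ℕ) (h0 : q 0 ∈ S)
    (hq : ∀ i < m, segment ℝ (q i) (q (i + 1)) ⊆ S) :
    geodesicDist S (q 0) (q m) ≤ ∑ i ∈ Finset.range m, edist (q i) (q (i + 1)) := by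
  induction m with
  | zero =>
    have := geodesicDist_le_of_lipschitz (S := S) LipschitzWith.id (a := q 0) (b := q 0)
      (by simpa using h0)
    simpa using this
  | succ m ih =>
    rw [Finset.sum_range_succ]
    exact (geodesicDist_triangle S _ (q m) _).trans (add_le_add (ih fun i hi => hq i (by omega))
      (geodesicDist_le_of_lipschitz LipschitzWith.id (hq m (by omega))))

/-- If the polygon inscribed in a shortest path at some dividing times stays in the surface, then the
path follows that polygon. -/
theorem IsShortestPath.mem_segment {S : Set (Amb d)} {x v : Amb d} {γ : Path x v}
    (hγ : IsShortestPath S γ) {t : ℕ → unitInterval} (ht : Monotone t) {n : ℕ} (ht0 : t 0 = 0)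
    (ht1 : t n = 1) (hseg : ∀ i < n, segment ℝ (γ (t i)) (γ (t (i + 1))) ⊆ S) :
    (∀ i < n, ∀ s ∈ Set.Icc (t i) (t (i + 1)), γ s ∈ segment ℝ (γ (t i)) (γ (t (i + 1)))) ∧
      ENNReal.ofReal (∑ i ∈ Finset.range n, dist (γ (t i)) (γ (t (i + 1)))) ≤ geodesicDist S x v := by
  set e : ℕ → ℝ≥0∞ := fun i => edist (γ (t i)) (γ (t (i + 1))) with he
  set V : ℕ → ℝ≥0∞ := fun i => eVariationOn γ (Set.Icc (t i) (t (i + 1))) with hV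
  have heV : ∀ i, e i ≤ V i := fun i =>
    eVariationOn.edist_le _ (Set.left_mem_Icc.2 (ht i.le_succ)) (Set.right_mem_Icc.2 (ht i.le_succ))
  have hsumV : ∑ i ∈ Finset.range n, V i = geodesicDist S x v := by
    rw [← hγ.2, pathLength, hV, eVariationOn.sum' _ ht, ht0, ht1]
    congr 1
    ext s
    exact ⟨fun _ => trivial, fun _ => ⟨unitInterval.nonneg s, unitInterval.le_one s⟩⟩
  have hsume : geodesicDist S x v ≤ ∑ i ∈ Finset.range n, e i := by
    have := geodesicDist_le_sum (S := S) (q := fun i => γ (t i)) n (hγ.1 _) hseg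
    simpa [ht0, ht1] using this
  -- Each `e j ≤ V j` while the sums compare the other way, so equality holds term by term;
  -- finiteness of the chords permits cancellation.
  have hVe : ∀ i < n, V i ≤ e i := by
    intro i hi
    have hi := Finset.mem_range.2 hi
    have h1 : ∑ j ∈ (Finset.range n).erase i, e j + V i ≤
        ∑ j ∈ (Finset.range n).erase i, e j + e i := by
      rw [Finset.sum_erase_add _ _ hi]
      refine le_trans ?_ (hsumV.le.trans hsume)
      rw [← Finset.sum_erase_add _ _ hi]
      gcongr with j
      exact heV j
    exact (ENNReal.add_le_add_iff_left (ENNReal.sum_ne_top.2 fun j _ => edist_ne_top _ _)).1 h1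
  refine ⟨fun i hi s hs => ?_, ?_⟩
  · have h1 : edist (γ (t i)) (γ s) + edist (γ s) (γ (t (i + 1))) ≤ e i := by
      refine le_trans ?_ (hVe i hi)
      have h2 := eVariationOn.Icc_add_Icc γ (s := Set.univ) hs.1 hs.2 (Set.mem_univ _)
      simp only [Set.univ_inter] at h2
      change _ ≤ eVariationOn γ (Set.Icc (t i) (t (i + 1)))
      rw [← h2]
      exact add_le_add
        (eVariationOn.edist_le _ (Set.left_mem_Icc.2 hs.1) (Set.right_mem_Icc.2 hs.1))
        (eVariationOn.edist_le _ (Set.left_mem_Icc.2 hs.2) (Set.right_mem_Icc.2 hs.2))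
    change _ ≤ edist (γ (t i)) (γ (t (i + 1))) at h1
    rw [edist_dist, edist_dist, edist_dist, ← ENNReal.ofReal_add dist_nonneg dist_nonneg,
      ENNReal.ofReal_le_ofReal_iff dist_nonneg] at h1
    rw [mem_segment_iff_wbtw, ← dist_add_dist_eq_iff]
    exact le_antisymm h1 (dist_triangle _ _ _)
  · rw [ENNReal.ofReal_sum_of_nonneg fun _ _ => dist_nonneg, ← hsumV]
    refine Finset.sum_le_sum fun i _ => ?_
    rw [← edist_dist]
    exact heV i

/-- If two points of a segment from `ν` are separated from `ν` by a hyperplane through the first one,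
then the first one lies between `ν` and the second one. -/
theorem mem_segment_of_le_of_lt {E : Type*} [NormedAddCommGroup E] [NormedSpace ℝ E]
    {l : E →L[ℝ] ℝ} {c : ℝ} {ν y p q : E} (hp : p ∈ segment ℝ ν y) (hq : q ∈ segment ℝ ν y)
    (hpc : l p = c) (hqc : l q ≤ c) (hν : c < l ν) : p ∈ segment ℝ ν q := by
  rw [segment_eq_image'] at hp hq ⊢
  obtain ⟨a, ⟨ha0, ha1⟩, rfl⟩ := hp
  obtain ⟨b, ⟨hb0, hb1⟩, rfl⟩ := hq
  simp only [map_add, map_smul, smul_eq_mul] at hpc hqc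
  set κ := l (y - ν) with hκ
  have hκ0 : κ < 0 := by nlinarith
  have hab : a ≤ b := by nlinarith
  have hb : 0 < b := by
    refine lt_of_le_of_ne hb0 fun h => ?_
    subst h
    linarith
  refine ⟨a / b, ⟨by positivity, (div_le_one hb).2 hab⟩, ?_⟩
  simp only [add_sub_cancel_left, smul_smul, div_mul_cancel₀ _ hb.ne']

theorem lt_of_mem_segment_of_lt {E : Type*} [NormedAddCommGroup E] [NormedSpace ℝ E]
    {l : E →L[ℝ] ℝ} {c : ℝ} {a b p : E} (hp : p ∈ segment ℝ a b) (ha : c ≤ l a) (hpc : l p < c) :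
    l b < c := by
  obtain ⟨s, t, hs, ht, hst, rfl⟩ := hp
  simp only [map_add, map_smul, smul_eq_mul] at hpc
  by_contra! h
  have : s * c + t * c = c := by rw [← add_mul, hst, one_mul]
  linarith [mul_le_mul_of_nonneg_left ha hs, mul_le_mul_of_nonneg_left h ht]

theorem IsometryEquiv.symm_mem_segment (Φ : Amb d ≃ᵢ Amb d) {p a b : Amb d}
    (h : Φ p ∈ segment ℝ a b) : p ∈ segment ℝ (Φ.symm a) (Φ.symm b) := by
  rw [segment_eq_image_lineMap] at h ⊢
  obtain ⟨t, ht, he⟩ := h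
  exact ⟨t, ht, by rw [← IsometryEquiv.apply_lineMap, he, Φ.symm_apply_apply]⟩

/-- Unfolding along a shortest path: seen from the unfolded source point, chains follow straight
segments to the points near the start of the path. -/
theorem unfolding_induction (hP : Convex ℝ P) {n : ℕ} {L : ℕ → Set (Amb d)}
    {Φ : ℕ → (Amb d ≃ᵢ Amb d)} {l : ℕ → Amb d →L[ℝ] ℝ} {c : ℕ → ℝ}
    (hL : ∀ i ≤ n, IsFacet P (L i)) (hR : ∀ i < n, IsRidge P (L i ∩ L (i + 1)))
    (hs : ∀ i ≤ n, SupportsFacet P (L i) (l i) (c i))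
    (hΦ : ∀ i < n, IsFoldingMap (L i) (L (i + 1)) (Φ i))
    {q : ℕ → Amb d} (hq : ∀ i ≤ n, q i ∈ L i ∧ q (i + 1) ∈ L i)
    (hprev : ∀ i < n, l i (q (i + 2)) < c i)
    (hnext : ∀ i, i + 1 < n → l (i + 2) (q (i + 1)) < c (i + 2))
    {ν y : ℕ → Amb d} (hνn : ν n = q (n + 1)) (hνs : ∀ i < n, Φ i (ν i) = ν (i + 1))
    (hline : ∀ i ≤ n, q i ∈ segment ℝ (ν i) (y i) ∧ q (i + 1) ∈ segment ℝ (ν i) (y i))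
    {T : Fin (n + 1) → Set (Amb d)} (hT : ∀ i, T i = {z | l i z = c i}) (k i : ℕ) (hik : i + k = n) :
    l i (ν i) = c i ∧ q (i + 1) ∈ segment ℝ (ν i) (q i) ∧
      dist (ν i) (q i) = ∑ j ∈ Finset.Ico i (n + 1), dist (q j) (q (j + 1)) ∧
      ∀ᶠ p in 𝓝[{p | l i p = c i ∧ (i < n → l (i + 1) p ≤ c (i + 1))}] (q i),
        ∃ r, FlatChain T (q (n + 1)) (k + 1) ⟨i, by omega⟩ p r ∧ r ≤ dist (ν i) p := by
  induction k generalizing i with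
  | zero =>
    obtain rfl : i = n := by omega
    have hv := (hs i le_rfl).apply_eq (hq i le_rfl).2
    refine ⟨hνn ▸ hv, hνn ▸ left_mem_segment ℝ _ _, ?_, ?_⟩
    · simp [hνn, dist_comm]
    · filter_upwards [self_mem_nhdsWithin] with p hp
      refine ⟨_, .single ?_ ?_, (hνn ▸ le_rfl)⟩
      · rw [hT]; exact hv
      · rw [hT]; exact hp.1
  | succ k ih =>
    obtain ⟨hν1, hseg1, hdist1, hev1⟩ := ih (i + 1) (by omega)
    have hin : i < n := by omega
    have hsi := hs i hin.le
    have hsi' := hs (i + 1) hin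
    have hqi := hsi.apply_eq (hq i hin.le).2
    have hqi' := hsi'.apply_eq (hq (i + 1) hin).1
    have hside : l i (ν (i + 1)) < c i :=
      lt_of_mem_segment_of_lt (segment_symm ℝ (ν (i + 1)) _ ▸ hseg1) hqi.ge (hprev i hin)
    have hνi : l i (ν i) = c i := by
      have h1 : ν (i + 1) ∈ (affineSpan ℝ (L (i + 1)) : Set (Amb d)) := by
        rw [hsi'.span]; exact hν1
      rw [← (hΦ i hin).image_span] at h1
      obtain ⟨a, ha, hae⟩ := h1
      rw [← hνs i hin] at hae
      rw [(Φ i).injective hae, hsi.span] at ha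
      exact ha
    have hfix : ∀ p, l i p = c i → l (i + 1) p = c (i + 1) → Φ i p = p := fun p h1 h2 => by
      refine (hΦ i hin).fix_span ?_
      rw [← SetLike.mem_coe, (hR i hin).span_eq (hL i hin.le) hsi hsi']
      exact ⟨h1, h2⟩
    have hdist : ∀ p, l i p = c i → l (i + 1) p = c (i + 1) → dist (ν (i + 1)) p = dist (ν i) p :=
      fun p h1 h2 => by
        conv_lhs => rw [← hνs i hin, ← hfix p h1 h2]
        exact (Φ i).dist_eq _ _
    -- Folding exchanges the sides of the ridge, so `ν i` lies beyond `T (i + 1)`, and a segment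
    -- from it to a point of `P` in `T i` has to cross the span of the ridge.
    have hbeyond : c (i + 1) < l (i + 1) (ν i) :=
      (hΦ i hin).lt_of_lt hP (hL i hin.le) (hL (i + 1) hin) hsi hsi' (hR i hin) hνi
        (by rw [hνs i hin]; exact hν1) (by rw [hνs i hin]; exact hside)
    have hseg : q (i + 1) ∈ segment ℝ (ν i) (q i) :=
      mem_segment_of_le_of_lt (hline i hin.le).2 (hline i hin.le).1 hqi'
        (hsi'.le _ (hsi.subset (hq i hin.le).1)) hbeyond
    refine ⟨hνi, hseg, ?_, ?_⟩
    · rw [← dist_add_dist_of_mem_segment hseg, ← hdist _ hqi hqi', hdist1,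
        Finset.sum_eq_sum_Ico_succ_bot (by omega : i < n + 1), dist_comm (q (i + 1)), add_comm]
    -- The inductive bound holds only on one side of `T (i + 2)`; `q (i + 1)` is strictly on that
    -- side, hence so are nearby crossing points.
    · have hB : ∀ᶠ p in 𝓝 (q (i + 1)), p ∈ T ⟨i, by omega⟩ → l (i + 1) p = c (i + 1) →
          p ∈ {p | l (i + 1) p = c (i + 1) ∧ (i + 1 < n → l (i + 1 + 1) p ≤ c (i + 1 + 1))} := by
        by_cases h : i + 1 < n
        · filter_upwards [(l (i + 2)).continuous.continuousAt.eventually (gt_mem_nhds (hnext i h))]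
            with p hp _ hpc
          exact ⟨hpc, fun _ => hp.le⟩
        · exact .of_forall fun p _ hpc => ⟨hpc, fun h' => absurd h' h⟩
      have hconv : Convex ℝ (T ⟨i, by omega⟩) := by
        rw [hT]; exact convex_hyperplane (l i).toLinearMap.isLinear _
      have := eventually_chain_snoc (T := T) (j := ⟨i, by omega⟩) hconv (by rw [hT]; exact hνi)
        (fun p hp hpc => hdist p (by rw [hT] at hp; exact hp) hpc) hB hev1 hbeyond hseg hqi'
      rw [eventually_nhdsWithin_iff]
      filter_upwards [this] with p hp hpm
      exact hp (by rw [hT]; exact hpm.1) (hpm.2 hin)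

end ShortestPaths

/-! ### The generalized Mount lemma -/

theorem mainTheorem9 (d : ℕ) (P : Set (Amb d)) (hP : IsConvexPolyhedron P)
    (F₀ : Set (Amb d)) (hF₀ : IsFacet P F₀)
    (v : Amb d) (hv : v ∈ intrinsicInterior ℝ F₀)
    (F : Set (Amb d)) (hF : IsFacet P F)
    (ν : Amb d) (hν : IsSourceImage P v F ν)
    (w : Amb d) (hw : w ∈ F) :
    segment ℝ ν w ⊆ (affineSpan ℝ F : Set (Amb d)) ∧
      geodesicDist (frontier P) v w ≤ edist ν w := by
  obtain ⟨x, hxF, -, γ, hγ, n, L, Φ, rfl, htr, hΦ, hνv, hunf⟩ := hν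
  have hcl := hP.isClosed
  have hc := hP.convex
  obtain ⟨t, htm, ht0, ht1, hmem, hint⟩ := htr.exists_monotone_times hcl
  have hsup : ∀ i, ∃ l c, i ≤ n → SupportsFacet P (L i) l c := fun i => by
    by_cases hi : i ≤ n
    · obtain ⟨l, c, h⟩ := (htr.facet i hi).exists_supportsFacet
      exact ⟨l, c, fun _ => h⟩
    · exact ⟨0, 0, fun h => absurd h hi⟩
  choose l c hs using hsup
  set q : ℕ → Amb d := fun i => γ (t i) with hqdef
  have hq0 : q 0 = x := by simp [hqdef, ht0]
  have hqn : q (n + 1) = v := by simp [hqdef, ht1]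
  have hq : ∀ i ≤ n, q i ∈ L i ∧ q (i + 1) ∈ L i := fun i hi =>
    ⟨hmem i hi _ (Set.left_mem_Icc.2 (htm i.le_succ)),
      hmem i hi _ (Set.right_mem_Icc.2 (htm i.le_succ))⟩
  -- The chords lie in single facets, which are convex, hence in the boundary; so the shortest path
  -- is straight inside each facet.
  obtain ⟨hstraight, hlen⟩ := hγ.mem_segment htm ht0 ht1 fun i hi =>
    (((hs i (by omega)).convex hc).segment_subset (hq i (by omega)).1 (hq i (by omega)).2).trans
      (hs i (by omega)).subset_frontier
  have hprev : ∀ i < n, l i (q (i + 2)) < c i := fun i hi => by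
    obtain ⟨s, hsI, hsint⟩ := hint (i + 1) (by omega) hi
    refine lt_of_mem_segment_of_lt (hstraight (i + 1) (by omega) s hsI)
      ((hs i hi.le).apply_eq (hq i hi.le).2).ge ?_
    exact (hs (i + 1) hi).lt_of_mem_intrinsicInterior (hs i hi.le) (htr.facet _ hi)
      (Set.inter_comm _ _ ▸ htr.ridge i hi) hsint
  have hnext : ∀ i, i + 1 < n → l (i + 2) (q (i + 1)) < c (i + 2) := fun i hi => by
    obtain ⟨s, hsI, hsint⟩ := hint (i + 1) (by omega) hi.le
    have h1 := hstraight (i + 1) (by omega) s hsI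
    rw [segment_symm] at h1
    refine lt_of_mem_segment_of_lt h1 ((hs (i + 2) hi).apply_eq (hq (i + 2) hi).1).ge ?_
    exact (hs (i + 1) hi.le).lt_of_mem_intrinsicInterior (hs (i + 2) hi) (htr.facet _ hi.le)
      (htr.ridge (i + 1) hi) hsint
  have hline : ∀ i ≤ n, ∀ p ∈ L i, p ∈ Set.range γ →
      p ∈ segment ℝ ((unfoldMap Φ i).symm ν) ((unfoldMap Φ i).symm x) := fun i hi p hpL hpγ => by
    refine IsometryEquiv.symm_mem_segment _ ?_
    rw [← hunf]
    exact Set.mem_biUnion (Set.mem_Iic.2 hi) ⟨p, ⟨hpγ, hpL⟩, rfl⟩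
  set T : Fin (n + 1) → Set (Amb d) := fun i => {z | l i z = c i} with hT
  obtain ⟨hν0, -, hdist, hev⟩ := unfolding_induction (T := T) hc htr.facet htr.ridge hs hΦ hq hprev
    hnext (ν := fun i => (unfoldMap Φ i).symm ν) (y := fun i => (unfoldMap Φ i).symm x)
    (by rw [hqn, ← hνv]; exact (unfoldMap Φ n).symm_apply_apply v)
    (fun i _ => rfl)
    (fun i hi => ⟨hline i hi _ (hq i hi).1 ⟨_, rfl⟩, hline i hi _ (hq i hi).2 ⟨_, rfl⟩⟩)
    (fun _ => rfl) n 0 (Nat.zero_add n)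
  change l 0 ν = c 0 at hν0
  change dist ν (q 0) = _ at hdist
  rw [hq0] at hdist hev
  rw [hqn] at hev
  have hs0 := hs 0 (Nat.zero_le n)
  have hsF : ∀ i : Fin (n + 1), SupportsFacet P (L i) (l i) (c i) := fun i => hs i (by omega)
  have hvP : v ∈ P := (hs n le_rfl).subset (hqn ▸ (hq n le_rfl).2)
  have hspan : ∀ i : Fin (n + 1), (affineSpan ℝ (L i) : Set (Amb d)) = T i := fun i => (hsF i).span
  have hgeo : ∀ {z k i r}, z ∈ P → FlatChain T v k i z r →
      geodesicDist (frontier P) v z ≤ ENNReal.ofReal r := fun hz h =>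
    h.geodesicDist_le hcl hc (fun i => (hsF i).ne_zero) (fun _ => rfl) (fun i => (hsF i).le) hvP hz
  refine ⟨?_, ?_⟩
  · refine (affineSpan ℝ (L 0)).convex.segment_subset ?_ (subset_affineSpan ℝ _ hw)
    rw [hs0.span]
    exact hν0
  obtain ⟨o, ho⟩ := (intrinsicInterior_nonempty (hs0.convex hc)).2 hF.1.1
  have hup : ∀ᶠ z in 𝓝[L 0] x, ∃ k ≤ n + 1, ∃ r, FlatChain T v k 0 z r ∧ r ≤ dist ν z := by
    refine Eventually.mono (nhdsWithin_mono _ (fun z hz => ?_) hev) fun z hz =>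
      ⟨n + 1, le_rfl, hz⟩
    -- Points of `F` lie in `P`, hence on the side of `T 1` where the unfolding bound holds, even if
    -- `x` itself is on `T 1`.
    exact ⟨hs0.apply_eq hz, fun h => (hs 1 h).le z (hs0.subset hz)⟩
  have hmain := chainDist_le_dist (T := T) (l := fun i : Fin (n + 1) => l i)
    (c := fun i : Fin (n + 1) => c i) (i := 0) (N := n + 1) (v := v) (ν := ν) (fun _ => rfl)
    (hs0.convex hc) (fun z hz => hs0.apply_eq hz) (fun i z hz => (hsF i).le z (hs0.subset hz))
    (intrinsicInterior_subset ho)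
    (fun i hi => by
      rw [← hspan, ← hspan, ← hF.eq_of_subset (htr.facet i (by omega)) (hs0.subset_of_mem_intrinsicInterior (hsF i) ho hi)]
      rfl)
    hxF hw hup (fun k r h => by
      have h1 := hgeo (hs0.subset hxF) h
      rw [geodesicDist_comm] at h1
      have h2 := hlen.trans h1
      rw [ENNReal.ofReal_le_ofReal_iff (dist_nonneg.trans h.dist_le)] at h2
      rw [hdist, ← Finset.range_eq_Ico]
      exact h2)
  obtain ⟨k, hk, r, hr, -⟩ := hup.self_of_nhdsWithin hxF
  obtain ⟨r', hr', -⟩ := hr.move_last (show w ∈ T 0 from hs0.apply_eq hw)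
  have hfin : geodesicDist (frontier P) v w ≠ ⊤ :=
    ((hgeo (hs0.subset hw) hr').trans_lt ENNReal.ofReal_lt_top).ne
  rw [edist_dist, ← ENNReal.ofReal_toReal hfin]
  refine ENNReal.ofReal_le_ofReal (hmain.trans' (le_csInf ⟨r', k, hk, hr'⟩ ?_))
  rintro r ⟨k, -, h⟩
  exact ENNReal.toReal_le_of_le_ofReal (dist_nonneg.trans h.dist_le) (hgeo (hs0.subset hw) h)
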